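/- Let $n\ge 0$ be an integer and let $\overline X$ be a compact smooth manifold with boundary of dimension $n+1$, with boundary $M=\partial\overline X$ and connected interior $X$. A defining function is a smooth $r:\overline X\to\mathbb R$ with $r>0$ on $X$, and $r=0$, $dr\neq 0$ on $M$. Let $g_+$ be a Poincaré–Einstein metric on $X$, that is, for some defining function $\rho$ the tensor $\rho^2g_+$ extends to a Riemannian metric on $\overline X$ of class $C^{3,\alpha}(\overline X)$, $0<\alpha<1$ (so that $g_+$ is a complete Riemannian metric on $X$), and $\mathrm{Ric}(g_+)=-n\,g_+$ on $X$. Let $r$ be any defining function, and let $u$ be a positive solution on $X$, of class $C^3$ (in particular, any smooth one), of $$\Delta_{g_+}u=(n+1)u,\qquad u-r^{-1}=O(1)\ \text{ as } r\to 0^+ .$$ Put $g_u=u^{-2}g_+$ on $X$, let $R_{g_u}$ be its scalar curvature and $E_{g_u}=\mathrm{Ric}_{g_u}-\frac{R_{g_u}}{n+1}\,g_u$ its trace-free Ricci tensor, and let $b(u)=\nabla^2_{g_+}u-u\,g_+$ be the trace-free Hessian of $u$. Then $$E_{g_u}=(n-1)\,\frac{b(u)}{u}\quad\text{on } X .$$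 Moreover, $b(u)=0$ on $X$ if and only if $R_{g_u}$ is constant on $X$. -/

import Mathlib

open scoped Manifold ContDiff Topology NNReal

noncomputable section

/-! ### Tensor calculus in a coordinate domain

A metric in local coordinates is a matrix-valued function `G` on `ℝᵐ`; all formulas below are the
classical coordinate formulas, evaluated at a point `y` near which `G` is `C²`. -/

section Coordinates

variable {m : ℕ}

/-- The partial derivative `∂ᵢ f` at `y`. -/
def coordPartial (i : Fin m) (f : EuclideanSpace ℝ (Fin m) → ℝ)
    (y : EuclideanSpace ℝ (Fin m)) : ℝ :=
  fderiv ℝ f y (EuclideanSpace.single i 1)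

/-- Christoffel symbols
`Γᵏᵢⱼ = ½ ∑ₗ Gᵏˡ (∂ᵢ Gⱼₗ + ∂ⱼ Gᵢₗ - ∂ₗ Gᵢⱼ)` of the Levi-Civita connection of `G`. -/
def christoffelSymbol (G : EuclideanSpace ℝ (Fin m) → Matrix (Fin m) (Fin m) ℝ)
    (k i j : Fin m) (y : EuclideanSpace ℝ (Fin m)) : ℝ :=
  (1 / 2) * ∑ l, (G y)⁻¹ k l *
    (coordPartial i (fun z => G z j l) y + coordPartial j (fun z => G z i l) y
      - coordPartial l (fun z => G z i j) y)

/-- Ricci curvature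
`Rᵢⱼ = ∑ₖ (∂ₖ Γᵏᵢⱼ - ∂ⱼ Γᵏᵢₖ) + ∑ₖₗ (Γᵏₖₗ Γˡᵢⱼ - Γᵏⱼₗ Γˡᵢₖ)`
(positive on round spheres, `-(m - 1) G` on hyperbolic space). -/
def coordRicci (G : EuclideanSpace ℝ (Fin m) → Matrix (Fin m) (Fin m) ℝ)
    (i j : Fin m) (y : EuclideanSpace ℝ (Fin m)) : ℝ :=
  (∑ k, (coordPartial k (christoffelSymbol G k i j) y
      - coordPartial j (christoffelSymbol G k i k) y))
    + ∑ k, ∑ l, (christoffelSymbol G k k l y * christoffelSymbol G l i j y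
      - christoffelSymbol G k j l y * christoffelSymbol G l i k y)

/-- Scalar curvature, the `G`-trace of the Ricci curvature. -/
def coordScalar (G : EuclideanSpace ℝ (Fin m) → Matrix (Fin m) (Fin m) ℝ)
    (y : EuclideanSpace ℝ (Fin m)) : ℝ :=
  ∑ i, ∑ j, (G y)⁻¹ i j * coordRicci G i j y

/-- Trace-free Ricci tensor `E = Ric - (R / m) G`, where `m` is the dimension. -/
def coordTraceFreeRicci (G : EuclideanSpace ℝ (Fin m) → Matrix (Fin m) (Fin m) ℝ)
    (i j : Fin m) (y : EuclideanSpace ℝ (Fin m)) : ℝ :=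
  coordRicci G i j y - coordScalar G y / m * G y i j

/-- The covariant Hessian `(∇²f)ᵢⱼ = ∂ᵢ∂ⱼ f - ∑ₖ Γᵏᵢⱼ ∂ₖ f`. -/
def coordHessian (G : EuclideanSpace ℝ (Fin m) → Matrix (Fin m) (Fin m) ℝ)
    (f : EuclideanSpace ℝ (Fin m) → ℝ) (i j : Fin m) (y : EuclideanSpace ℝ (Fin m)) : ℝ :=
  coordPartial i (coordPartial j f) y - ∑ k, christoffelSymbol G k i j y * coordPartial k f y

/-- The Laplace-Beltrami operator, the `G`-trace of the covariant Hessian. -/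
def coordLaplacian (G : EuclideanSpace ℝ (Fin m) → Matrix (Fin m) (Fin m) ℝ)
    (f : EuclideanSpace ℝ (Fin m) → ℝ) (y : EuclideanSpace ℝ (Fin m)) : ℝ :=
  ∑ i, ∑ j, (G y)⁻¹ i j * coordHessian G f i j y

end Coordinates

/-! ### Tensors on a manifold with boundary

`X` is an `(n+1)`-dimensional smooth manifold with boundary; its interior is
`(𝓡∂ (n + 1)).interior X` and its boundary is `(𝓡∂ (n + 1)).boundary X`. -/

section Manifold

variable {n : ℕ} {X : Type*} [TopologicalSpace X] [ChartedSpace (EuclideanHalfSpace (n + 1)) X]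

/-- A field of bilinear forms on the tangent spaces of `X`. (No regularity is built in. A tensor
field that lives on the interior only is represented by its values there; its values at boundary
points are never used.) -/
abbrev BilinField (n : ℕ) (X : Type*) [TopologicalSpace X]
    [ChartedSpace (EuclideanHalfSpace (n + 1)) X] : Type _ :=
  ∀ x : X, TangentSpace (𝓡∂ (n + 1)) x →L[ℝ] TangentSpace (𝓡∂ (n + 1)) x →L[ℝ] ℝ

/-- The coordinate vector field `∂ᵢ` of the chart `e`, at the point with coordinates `y`. -/
def coordField (e : OpenPartialHomeomorph X (EuclideanHalfSpace (n + 1))) (i : Fin (n + 1))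
    (y : EuclideanSpace ℝ (Fin (n + 1))) :
    TangentSpace (𝓡∂ (n + 1)) ((e.extend (𝓡∂ (n + 1))).symm y) :=
  mfderivWithin 𝓘(ℝ, EuclideanSpace ℝ (Fin (n + 1))) (𝓡∂ (n + 1))
    (e.extend (𝓡∂ (n + 1))).symm (Set.range (𝓡∂ (n + 1))) y
    (EuclideanSpace.single i (1 : ℝ) : EuclideanSpace ℝ (Fin (n + 1)))

/-- The components `gᵢⱼ = g(∂ᵢ, ∂ⱼ)` of `g` in the chart `e`, as functions of the coordinates. -/
def components (e : OpenPartialHomeomorph X (EuclideanHalfSpace (n + 1)))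
    (g : BilinField n X) (y : EuclideanSpace ℝ (Fin (n + 1))) :
    Matrix (Fin (n + 1)) (Fin (n + 1)) ℝ :=
  Matrix.of fun i j => g ((e.extend (𝓡∂ (n + 1))).symm y) (coordField e i y) (coordField e j y)

/-- A function on `X` read in the chart `e`. -/
def inChart (e : OpenPartialHomeomorph X (EuclideanHalfSpace (n + 1)))
    (f : X → ℝ) : EuclideanSpace ℝ (Fin (n + 1)) → ℝ :=
  f ∘ (e.extend (𝓡∂ (n + 1))).symm

/-- Components at `x` of the Ricci tensor of `g` in the chart `e`. -/
def ricci (g : BilinField n X) (e : OpenPartialHomeomorph X (EuclideanHalfSpace (n + 1)))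
    (x : X) : Matrix (Fin (n + 1)) (Fin (n + 1)) ℝ :=
  Matrix.of fun i j => coordRicci (components e g) i j (e.extend (𝓡∂ (n + 1)) x)

/-- Scalar curvature of `g` at `x`, computed in the chart `e`. -/
def scalarCurvature (g : BilinField n X)
    (e : OpenPartialHomeomorph X (EuclideanHalfSpace (n + 1))) (x : X) : ℝ :=
  coordScalar (components e g) (e.extend (𝓡∂ (n + 1)) x)

/-- Components at `x` of the trace-free Ricci tensor `Ric - (R / (n + 1)) g` in the chart `e`. -/
def traceFreeRicci (g : BilinField n X)
    (e : OpenPartialHomeomorph X (EuclideanHalfSpace (n + 1)))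
    (x : X) : Matrix (Fin (n + 1)) (Fin (n + 1)) ℝ :=
  Matrix.of fun i j => coordTraceFreeRicci (components e g) i j (e.extend (𝓡∂ (n + 1)) x)

/-- Components at `x` of the covariant Hessian `∇²u` with respect to `g` in the chart `e`. -/
def hessian (g : BilinField n X) (u : X → ℝ)
    (e : OpenPartialHomeomorph X (EuclideanHalfSpace (n + 1)))
    (x : X) : Matrix (Fin (n + 1)) (Fin (n + 1)) ℝ :=
  Matrix.of fun i j => coordHessian (components e g) (inChart e u) i j (e.extend (𝓡∂ (n + 1)) x)

/-- The Laplace-Beltrami operator of `g` applied to `u` at `x`, computed in the chart `e`. -/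
def laplacian (g : BilinField n X) (u : X → ℝ)
    (e : OpenPartialHomeomorph X (EuclideanHalfSpace (n + 1))) (x : X) : ℝ :=
  coordLaplacian (components e g) (inChart e u) (e.extend (𝓡∂ (n + 1)) x)

/-- Components at `x` of `b(u) = ∇²u - u g` in the chart `e`. -/
def hessianDefect (g : BilinField n X) (u : X → ℝ)
    (e : OpenPartialHomeomorph X (EuclideanHalfSpace (n + 1)))
    (x : X) : Matrix (Fin (n + 1)) (Fin (n + 1)) ℝ :=
  hessian g u e x - u x • components e g (e.extend (𝓡∂ (n + 1)) x)

/-- `P e x` holds for every interior point `x` and every smooth chart `e` of `X` around `x`. For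
the components of tensors this is the coordinate form of a tensor identity on the interior. -/
def InteriorCharts (P : OpenPartialHomeomorph X (EuclideanHalfSpace (n + 1)) → X → Prop) : Prop :=
  ∀ e ∈ IsManifold.maximalAtlas (𝓡∂ (n + 1)) ∞ X,
    ∀ x ∈ e.source, x ∈ (𝓡∂ (n + 1)).interior X → P e x

/-- Smooth defining functions for the boundary. -/
structure IsDefiningFunction (r : X → ℝ) : Prop where
  smooth : ContMDiff (𝓡∂ (n + 1)) 𝓘(ℝ, ℝ) ∞ r
  pos : ∀ x ∈ (𝓡∂ (n + 1)).interior X, 0 < r x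
  zero : ∀ x ∈ (𝓡∂ (n + 1)).boundary X, r x = 0
  deriv_ne_zero : ∀ x ∈ (𝓡∂ (n + 1)).boundary X, mfderiv (𝓡∂ (n + 1)) 𝓘(ℝ, ℝ) r x ≠ 0

/-- `f` is `C^{3,α}` on `s`, locally uniformly and up to those boundary points of `s` that belong
to `s`. -/
def IsC3Holder (α : ℝ≥0) (f : EuclideanSpace ℝ (Fin (n + 1)) → ℝ)
    (s : Set (EuclideanSpace ℝ (Fin (n + 1)))) : Prop :=
  ContDiffOn ℝ 3 f s ∧
    ∀ y ∈ s, ∃ t ∈ 𝓝[s] y, ∃ C : ℝ≥0, HolderOnWith C α (iteratedFDerivWithin ℝ 3 f s) t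

/-- `h` is a Riemannian metric of class `C^{3,α}` on all of `X`, boundary included. -/
structure IsC3HolderMetric (α : ℝ≥0) (h : BilinField n X) : Prop where
  symm : ∀ x v w, h x v w = h x w v
  pos : ∀ x v, v ≠ 0 → 0 < h x v v
  regular : ∀ e ∈ IsManifold.maximalAtlas (𝓡∂ (n + 1)) ∞ X, ∀ i j,
    IsC3Holder α (fun y => components e h y i j) (e.extend (𝓡∂ (n + 1))).target

/-- `g` is a Poincaré-Einstein metric on the interior of the compact manifold `X`: for some
defining function `ρ`, `ρ² g` extends to a Riemannian metric of class `C^{3,α}`, `0 < α < 1`, on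
`X`, and `Ric(g) = -n g` on the interior. (The first condition implies that `g` is a complete
Riemannian metric on the interior, since `X` is compact.) -/
structure IsPoincareEinstein (g : BilinField n X) : Prop where
  conformallyCompact : ∃ ρ : X → ℝ, IsDefiningFunction (n := n) ρ ∧
    ∃ α : ℝ≥0, 0 < α ∧ α < 1 ∧ ∃ h : BilinField n X, IsC3HolderMetric α h ∧
      ∀ x ∈ (𝓡∂ (n + 1)).interior X, h x = ρ x ^ 2 • g x
  einstein : InteriorCharts (n := n) fun e x =>
    ricci g e x = (-(n : ℝ)) • components e g (e.extend (𝓡∂ (n + 1)) x)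

/-- `u` is a positive solution on the interior of `Δu = (n + 1) u` with `u - r⁻¹ = O(1)` as
`r → 0⁺`. -/
structure IsNormalizedEigenfunction (g : BilinField n X) (r u : X → ℝ) : Prop where
  regular : ContMDiffOn (𝓡∂ (n + 1)) 𝓘(ℝ, ℝ) 3 u ((𝓡∂ (n + 1)).interior X)
  pos : ∀ x ∈ (𝓡∂ (n + 1)).interior X, 0 < u x
  eigen : InteriorCharts (n := n) fun e x => laplacian g u e x = ((n : ℝ) + 1) * u x
  asymptotics : (fun x => u x - (r x)⁻¹) =O[Filter.comap r (𝓝[>] 0)] (fun _ => (1 : ℝ))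

/-- The conformal metric `g_u = u⁻² g`. -/
def conformalMetric (g : BilinField n X) (u : X → ℝ) : BilinField n X :=
  fun x => (u x ^ 2)⁻¹ • g x

end Manifold

end

/-!
Everything is a local computation with the function `F = u² - |du|²` (norm taken in `g`), carried
out in the interior of an arbitrary chart, where `g` becomes a `C³` positive definite matrix field
`G`, `u` a positive `C³` function `v`, and `m = n + 1` is the dimension.

The conformal transformation law (`IsC2MetricOn.coordRicci_conformal`) gives
`Ric(v⁻² G) = Ric(G) + (m - 2) ∇²v / v + (Δv / v - (m - 1) |dv|² / v²) G`. It is obtained from the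
difference `T` of the two connections (`conformalShift`): the derivatives of `T` contribute second
derivatives of `v`, and `quadratic_conformalShift` collects the products. Inserting
`Ric(G) = -(m - 1) G` and `Δv = m v`, the scalar curvature of `v⁻² G` is `m (m - 1) F`, and the
trace-free part of its Ricci tensor is `(m - 2) b / v` with `b = ∇²v - v G`.

If `b = 0` then `dF = -2 b(∇v, ·) = 0`, so `F` is locally constant. As `|du|²` is chart independent
(`coordNormSqDiff_eq_of_charts`, by duality with `du`), `F` is a function on the connected interior,
hence constant, and so is the scalar curvature.

Conversely, let the scalar curvature be constant. If `m = 1`, then `b` is trace free in dimension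
one and vanishes. If `m ≥ 2`, then `F` is constant, so `b(∇v, ·) = 0`. The contracted Ricci identity
(`IsC2MetricOn.divergence_coordCovariantDeriv`) and the Einstein equation show that `b` is
divergence free, so taking the divergence of `b(∇v, ·) = 0` leaves `⟨b, ∇²v⟩ = 0`, which is
`|b|² = 0` because `b` is trace free (`IsEinsteinEigenpairOn.coordHessian_eq_of_eventually_const`).
-/

/-! ### Partial derivatives and the Levi-Civita connection -/

section CoordinateCalculus

variable {m : ℕ} {f h : EuclideanSpace ℝ (Fin m) → ℝ} {y : EuclideanSpace ℝ (Fin m)}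

lemma sum_smul_single (w : EuclideanSpace ℝ (Fin m)) :
    w = ∑ i, w i • EuclideanSpace.single i (1 : ℝ) := by
  ext j; simp [Pi.single_apply]

lemma coordPartial_add (hf : DifferentiableAt ℝ f y) (hh : DifferentiableAt ℝ h y) (i : Fin m) :
    coordPartial i (fun z => f z + h z) y = coordPartial i f y + coordPartial i h y := by
  simp [coordPartial, fderiv_fun_add hf hh]

lemma coordPartial_sub (hf : DifferentiableAt ℝ f y) (hh : DifferentiableAt ℝ h y) (i : Fin m) :
    coordPartial i (fun z => f z - h z) y = coordPartial i f y - coordPartial i h y := by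
  simp [coordPartial, fderiv_fun_sub hf hh]

lemma coordPartial_mul (hf : DifferentiableAt ℝ f y) (hh : DifferentiableAt ℝ h y) (i : Fin m) :
    coordPartial i (fun z => f z * h z) y
      = coordPartial i f y * h y + f y * coordPartial i h y := by
  simp [coordPartial, fderiv_fun_mul hf hh]; ring

lemma coordPartial_inv (hf : DifferentiableAt ℝ f y) (h0 : f y ≠ 0) (i : Fin m) :
    coordPartial i (fun z => (f z)⁻¹) y = -coordPartial i f y / f y ^ 2 := by
  have h := (hasDerivAt_inv h0).comp_hasFDerivAt y hf.hasFDerivAt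
  have h' : fderiv ℝ (fun z => (f z)⁻¹) y = -(f y ^ 2)⁻¹ • fderiv ℝ f y := h.fderiv
  rw [coordPartial, h', coordPartial, smul_apply, smul_eq_mul]
  ring

lemma coordPartial_div (hf : DifferentiableAt ℝ f y) (hh : DifferentiableAt ℝ h y) (h0 : h y ≠ 0)
    (i : Fin m) : coordPartial i (fun z => f z / h z) y
      = coordPartial i f y / h y - f y / h y * (coordPartial i h y / h y) := by
  simp only [div_eq_mul_inv (f _)]
  rw [coordPartial_mul hf (hh.fun_inv h0), coordPartial_inv hh h0]
  field_simp
  ring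

lemma coordPartial_const_mul (hf : DifferentiableAt ℝ f y) (c : ℝ) (i : Fin m) :
    coordPartial i (fun z => c * f z) y = c * coordPartial i f y := by
  simp [coordPartial, fderiv_const_mul hf]

lemma coordPartial_const (c : ℝ) (i : Fin m) : coordPartial i (fun _ => c) y = 0 := by
  simp [coordPartial]

lemma coordPartial_sum {ι : Type*} (s : Finset ι) {F : ι → EuclideanSpace ℝ (Fin m) → ℝ}
    (hF : ∀ a ∈ s, DifferentiableAt ℝ (F a) y) (i : Fin m) :
    coordPartial i (fun z => ∑ a ∈ s, F a z) y = ∑ a ∈ s, coordPartial i (F a) y := by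
  simp [coordPartial, fderiv_fun_sum hF]

lemma coordPartial_congr (hfh : f =ᶠ[𝓝 y] h) (i : Fin m) :
    coordPartial i f y = coordPartial i h y := by
  rw [coordPartial, hfh.fderiv_eq, coordPartial]

lemma ContDiffAt.coordPartial {k l : WithTop ℕ∞} (hf : ContDiffAt ℝ l f y) (hkl : k + 1 ≤ l)
    (i : Fin m) : ContDiffAt ℝ k (coordPartial i f) y :=
  (hf.fderiv_right hkl).clm_apply contDiffAt_const

lemma coordPartial_comm (hf : ContDiffAt ℝ 2 f y) (i j : Fin m) :
    coordPartial i (coordPartial j f) y = coordPartial j (coordPartial i f) y := by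
  have hd : DifferentiableAt ℝ (fderiv ℝ f) y :=
    (hf.fderiv_right (m := 1) (by norm_num)).differentiableAt one_ne_zero
  have key : ∀ a b : Fin m, coordPartial a (coordPartial b f) y
      = fderiv ℝ (fderiv ℝ f) y (EuclideanSpace.single a 1) (EuclideanSpace.single b 1) := by
    intro a b
    unfold coordPartial
    rw [fderiv_clm_apply hd (differentiableAt_const _)]
    simp
  rw [key, key]
  exact hf.isSymmSndFDerivAt (by simp) _ _

variable {G : EuclideanSpace ℝ (Fin m) → Matrix (Fin m) (Fin m) ℝ}
  {U : Set (EuclideanSpace ℝ (Fin m))}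

/-- A positive definite symmetric matrix field of class `C²` on the open set `U`: a Riemannian
metric in coordinates. -/
structure IsC2MetricOn (G : EuclideanSpace ℝ (Fin m) → Matrix (Fin m) (Fin m) ℝ)
    (U : Set (EuclideanSpace ℝ (Fin m))) : Prop where
  isOpen : IsOpen U
  posDef : ∀ y ∈ U, (G y).PosDef
  contDiffAt : ∀ y ∈ U, ∀ i j, ContDiffAt ℝ 2 (fun z => G z i j) y

lemma contDiffAt_matrix_det {k : WithTop ℕ∞} {ι : Type*} [Fintype ι] [DecidableEq ι]
    {A : EuclideanSpace ℝ (Fin m) → Matrix ι ι ℝ}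
    (hA : ∀ i j, ContDiffAt ℝ k (fun z => A z i j) y) :
    ContDiffAt ℝ k (fun z => (A z).det) y := by
  simp only [Matrix.det_apply]
  refine ContDiffAt.sum fun σ _ => ContDiffAt.const_smul _ ?_
  exact contDiffAt_prod fun i _ => hA _ _

lemma contDiffAt_matrix_inv {k : WithTop ℕ∞} {ι : Type*} [Fintype ι] [DecidableEq ι]
    {A : EuclideanSpace ℝ (Fin m) → Matrix ι ι ℝ}
    (hA : ∀ i j, ContDiffAt ℝ k (fun z => A z i j) y) (hdet : (A y).det ≠ 0) (i j : ι) :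
    ContDiffAt ℝ k (fun z => (A z)⁻¹ i j) y := by
  simp only [Matrix.inv_def, Matrix.smul_apply, Ring.inverse_eq_inv', smul_eq_mul,
    Matrix.adjugate_apply]
  refine ((contDiffAt_matrix_det hA).inv hdet).mul (contDiffAt_matrix_det fun a b => ?_)
  by_cases hb : a = j
  · subst hb; simpa using contDiffAt_const
  · simpa [Matrix.updateRow_ne hb] using hA a b

namespace IsC2MetricOn

variable (hG : IsC2MetricOn G U) (hy : y ∈ U)
include hG hy

lemma eventually_mem : ∀ᶠ z in 𝓝 y, z ∈ U := hG.isOpen.mem_nhds hy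

lemma isUnit_det : IsUnit (G y).det := (hG.posDef y hy).det_pos.ne'.isUnit

lemma apply_comm (i j : Fin m) : G y i j = G y j i := by
  simpa using (hG.posDef y hy).isHermitian.apply j i

lemma inv_comm (i j : Fin m) : (G y)⁻¹ i j = (G y)⁻¹ j i := by
  simpa using (hG.posDef y hy).inv.isHermitian.apply j i

lemma contDiffAt_inv (i j : Fin m) : ContDiffAt ℝ 2 (fun z => (G z)⁻¹ i j) y :=
  contDiffAt_matrix_inv (hG.contDiffAt y hy) (hG.isUnit_det hy).ne_zero i j

lemma sum_mul_inv (i j : Fin m) : ∑ k, G y i k * (G y)⁻¹ k j = if i = j then 1 else 0 := by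
  rw [← Matrix.mul_apply, Matrix.mul_nonsing_inv _ (hG.isUnit_det hy), Matrix.one_apply]

lemma sum_inv_mul (i j : Fin m) : ∑ k, (G y)⁻¹ i k * G y k j = if i = j then 1 else 0 := by
  rw [← Matrix.mul_apply, Matrix.nonsing_inv_mul _ (hG.isUnit_det hy), Matrix.one_apply]

lemma contDiffAt_christoffel (k i j : Fin m) : ContDiffAt ℝ 1 (christoffelSymbol G k i j) y := by
  have hd : ∀ a b c, ContDiffAt ℝ 1 (coordPartial a (fun z => G z b c)) y := fun a b c =>
    (hG.contDiffAt y hy b c).coordPartial (by norm_num) a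
  exact contDiffAt_const.mul (ContDiffAt.sum fun l _ =>
    ((hG.contDiffAt_inv hy k l).of_le (by norm_num)).mul (((hd _ _ _).add (hd _ _ _)).sub
      (hd _ _ _)))

lemma christoffel_comm (k i j : Fin m) :
    christoffelSymbol G k i j y = christoffelSymbol G k j i y := by
  have : ∀ l, coordPartial l (fun z => G z i j) y = coordPartial l (fun z => G z j i) y :=
    fun l => coordPartial_congr ((hG.eventually_mem hy).mono fun z hz => hG.apply_comm hz i j) l
  simp only [christoffelSymbol, this]
  congr 1
  exact Finset.sum_congr rfl fun l _ => by ring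

/-- The Christoffel symbols with lowered upper index. -/
lemma sum_metric_mul_christoffel (p i j : Fin m) :
    ∑ k, G y p k * christoffelSymbol G k i j y = (1 / 2) * (coordPartial i (fun z => G z j p) y
      + coordPartial j (fun z => G z i p) y - coordPartial p (fun z => G z i j) y) := by
  simp only [christoffelSymbol, Finset.mul_sum]
  rw [Finset.sum_comm]
  calc _ = ∑ l, (∑ k, G y p k * (G y)⁻¹ k l) * ((1 / 2) * (coordPartial i (fun z => G z j l) y
      + coordPartial j (fun z => G z i l) y - coordPartial l (fun z => G z i j) y)) := by
        refine Finset.sum_congr rfl fun l _ => ?_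
        rw [Finset.sum_mul]
        exact Finset.sum_congr rfl fun k _ => by ring
    _ = _ := by simp [hG.sum_mul_inv hy]

/-- The connection is metric: `∇G = 0`. -/
lemma coordPartial_metric (k i j : Fin m) :
    coordPartial k (fun z => G z i j) y
      = ∑ l, (G y l j * christoffelSymbol G l k i y + G y i l * christoffelSymbol G l k j y) := by
  have hsymm : ∀ a b c, coordPartial a (fun z => G z b c) y = coordPartial a (fun z => G z c b) y :=
    fun a b c => coordPartial_congr
      ((hG.eventually_mem hy).mono fun z hz => hG.apply_comm hz b c) a
  simp only [Finset.sum_add_distrib, hG.apply_comm hy _ j]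
  rw [hG.sum_metric_mul_christoffel hy, hG.sum_metric_mul_christoffel hy, hsymm k j i]
  ring

/-- The connection is metric: `∇G⁻¹ = 0`. -/
lemma coordPartial_inverseMetric (k i j : Fin m) :
    coordPartial k (fun z => (G z)⁻¹ i j) y
      = -∑ l, ((G y)⁻¹ l j * christoffelSymbol G i k l y
        + (G y)⁻¹ i l * christoffelSymbol G j k l y) := by
  have hGd : ∀ a b, DifferentiableAt ℝ (fun z => G z a b) y := fun a b =>
    (hG.contDiffAt y hy a b).differentiableAt (by norm_num)
  have hId : ∀ a b, DifferentiableAt ℝ (fun z => (G z)⁻¹ a b) y := fun a b =>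
    (hG.contDiffAt_inv hy a b).differentiableAt (by norm_num)
  let Γ : Matrix (Fin m) (Fin m) ℝ := Matrix.of fun l a => christoffelSymbol G l k a y
  let D : Matrix (Fin m) (Fin m) ℝ := Matrix.of fun a b => coordPartial k (fun z => G z a b) y
  let D' : Matrix (Fin m) (Fin m) ℝ :=
    Matrix.of fun a b => coordPartial k (fun z => (G z)⁻¹ a b) y
  have hD : D = Γ.transpose * G y + G y * Γ := by
    ext a b
    simp only [D, Γ, Matrix.of_apply, hG.coordPartial_metric hy, Matrix.add_apply,
      Matrix.mul_apply, Matrix.transpose_apply, Finset.sum_add_distrib]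
    congr 1
    exact Finset.sum_congr rfl fun l _ => mul_comm _ _
  have hprod : D * (G y)⁻¹ + G y * D' = 0 := by
    ext a b
    have h0 : coordPartial k (fun z => ∑ l, G z a l * (G z)⁻¹ l b) y = 0 := by
      rw [coordPartial_congr (h := fun _ => if a = b then 1 else 0)
        ((hG.eventually_mem hy).mono fun z hz => hG.sum_mul_inv hz a b), coordPartial_const]
    rw [coordPartial_sum (F := fun l z => G z a l * (G z)⁻¹ l b) _
      fun l _ => (hGd a l).fun_mul (hId l b)] at h0
    simp only [coordPartial_mul (hGd a _) (hId _ b), Finset.sum_add_distrib] at h0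
    simpa [D, D', Matrix.mul_apply] using h0
  have hu := hG.isUnit_det hy
  have hD' : D' = -((G y)⁻¹ * Γ.transpose + Γ * (G y)⁻¹) := by
    have h1 : (G y)⁻¹ * (D * (G y)⁻¹ + G y * D') = 0 := by rw [hprod, mul_zero]
    rw [hD, mul_add, ← mul_assoc _ (G y) D', Matrix.nonsing_inv_mul _ hu, one_mul, add_mul,
      mul_assoc _ (G y) _, Matrix.mul_nonsing_inv _ hu, mul_one, mul_add, mul_assoc (G y) Γ,
      ← mul_assoc _ (G y) _, Matrix.nonsing_inv_mul _ hu, one_mul] at h1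
    exact eq_neg_of_add_eq_zero_right h1
  have h2 := congrFun (congrFun hD' i) j
  simp only [D', Γ, Matrix.of_apply, Matrix.neg_apply, Matrix.add_apply, Matrix.mul_apply,
    Matrix.transpose_apply] at h2
  rw [h2, Finset.sum_add_distrib, add_comm]
  congr 2
  exact Finset.sum_congr rfl fun l _ => mul_comm _ _

end IsC2MetricOn

end CoordinateCalculus

/-! ### Conformal change of the Ricci curvature -/

section ConformalChange

variable {m : ℕ} {f v : EuclideanSpace ℝ (Fin m) → ℝ} {y : EuclideanSpace ℝ (Fin m)}
  {G : EuclideanSpace ℝ (Fin m) → Matrix (Fin m) (Fin m) ℝ} {U : Set (EuclideanSpace ℝ (Fin m))}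

/-- The components `fᵏ = ∑ₗ Gᵏˡ ∂ₗ f` of the gradient of `f`. -/
noncomputable def coordGradient (G : EuclideanSpace ℝ (Fin m) → Matrix (Fin m) (Fin m) ℝ)
    (f : EuclideanSpace ℝ (Fin m) → ℝ) (k : Fin m) (y : EuclideanSpace ℝ (Fin m)) : ℝ :=
  ∑ l, (G y)⁻¹ k l * coordPartial l f y

/-- The squared norm `|df|²` of the differential of `f`. -/
noncomputable def coordNormSqDiff (G : EuclideanSpace ℝ (Fin m) → Matrix (Fin m) (Fin m) ℝ)
    (f : EuclideanSpace ℝ (Fin m) → ℝ) (y : EuclideanSpace ℝ (Fin m)) : ℝ :=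
  ∑ k, coordGradient G f k y * coordPartial k f y

namespace IsC2MetricOn

variable (hG : IsC2MetricOn G U) (hy : y ∈ U)
include hG hy

lemma contDiffAt_coordGradient (hf : ContDiffAt ℝ 3 f y) (k : Fin m) :
    ContDiffAt ℝ 2 (coordGradient G f k) y :=
  ContDiffAt.sum fun l _ => (hG.contDiffAt_inv hy k l).mul (hf.coordPartial (by norm_num) l)

lemma sum_metric_mul_coordGradient (i : Fin m) :
    ∑ k, G y i k * coordGradient G f k y = coordPartial i f y := by
  simp only [coordGradient, Finset.mul_sum]
  rw [Finset.sum_comm]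
  simp only [← mul_assoc, ← Finset.sum_mul, hG.sum_mul_inv hy]
  simp

lemma coordHessian_comm (hf : ContDiffAt ℝ 2 f y) (i j : Fin m) :
    coordHessian G f i j y = coordHessian G f j i y := by
  simp only [coordHessian, coordPartial_comm hf i j, hG.christoffel_comm hy _ i j]

/-- Raising an index commutes with covariant differentiation: `∇ᵢfʲ = ∑ₗ Gʲˡ (∇²f)ᵢₗ`. -/
lemma covariantDerivative_coordGradient (hf : ContDiffAt ℝ 2 f y) (i j : Fin m) :
    coordPartial i (coordGradient G f j) y
        + ∑ l, christoffelSymbol G j i l y * coordGradient G f l y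
      = ∑ l, (G y)⁻¹ j l * coordHessian G f i l y := by
  have hId : ∀ a b, DifferentiableAt ℝ (fun z => (G z)⁻¹ a b) y := fun a b =>
    (hG.contDiffAt_inv hy a b).differentiableAt (by norm_num)
  have hfd : ∀ a, DifferentiableAt ℝ (coordPartial a f) y := fun a =>
    (hf.coordPartial (k := 1) (by norm_num) a).differentiableAt one_ne_zero
  have h1 : coordPartial i (coordGradient G f j) y
      = ∑ l, (coordPartial i (fun z => (G z)⁻¹ j l) y * coordPartial l f y
        + (G y)⁻¹ j l * coordPartial i (coordPartial l f) y) := by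
    unfold coordGradient
    rw [coordPartial_sum (F := fun l z => (G z)⁻¹ j l * coordPartial l f z) _
      fun l _ => (hId j l).fun_mul (hfd l)]
    exact Finset.sum_congr rfl fun l _ => coordPartial_mul (hId j l) (hfd l) i
  have e1 : ∑ x, (∑ l, (G y)⁻¹ l x * christoffelSymbol G j i l y) * coordPartial x f y
      = ∑ l, christoffelSymbol G j i l y * coordGradient G f l y := by
    simp only [coordGradient, Finset.sum_mul, Finset.mul_sum]
    rw [Finset.sum_comm]
    exact Finset.sum_congr rfl fun _ _ => Finset.sum_congr rfl fun _ _ => by ring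
  have e2 : ∑ x, (∑ l, (G y)⁻¹ j l * christoffelSymbol G x i l y) * coordPartial x f y
      = ∑ l, (G y)⁻¹ j l * ∑ k, christoffelSymbol G k i l y * coordPartial k f y := by
    simp only [Finset.sum_mul, Finset.mul_sum]
    rw [Finset.sum_comm]
    exact Finset.sum_congr rfl fun _ _ => Finset.sum_congr rfl fun _ _ => by ring
  rw [h1]
  simp only [hG.coordPartial_inverseMetric hy, coordHessian, mul_sub, Finset.sum_sub_distrib,
    Finset.sum_add_distrib, neg_mul, add_mul, Finset.sum_neg_distrib]
  rw [e1, e2]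
  ring

/-- The Laplacian is the divergence of the gradient. -/
lemma divergence_coordGradient (hf : ContDiffAt ℝ 2 f y) :
    ∑ k, (coordPartial k (coordGradient G f k) y
        + ∑ l, christoffelSymbol G k k l y * coordGradient G f l y) = coordLaplacian G f y := by
  simp only [hG.covariantDerivative_coordGradient hy hf, coordLaplacian]

end IsC2MetricOn

/-- The difference `Tᵏᵢⱼ` of the Christoffel symbols of `v⁻² G` and `G` at a point, where `g` is the
value of `G`, `p = dv / v` and `P` is the vector dual to `p`. -/
noncomputable def conformalShift {m : ℕ} (g : Fin m → Fin m → ℝ) (p P : Fin m → ℝ)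
    (k i j : Fin m) : ℝ :=
  g i j * P k - (if k = j then p i else 0) - (if k = i then p j else 0)

section Algebra

variable {g : Fin m → Fin m → ℝ} {p P : Fin m → ℝ}

lemma sum_conformalShift (hgP : ∀ i, ∑ k, g i k * P k = p i) (i : Fin m) :
    ∑ k, conformalShift g p P k i k = -m * p i := by
  simp [conformalShift, Finset.sum_sub_distrib, hgP]

lemma conformalShift_comm (hg : ∀ i j, g i j = g j i) (k i j : Fin m) :
    conformalShift g p P k i j = conformalShift g p P k j i := by
  simp only [conformalShift, hg i j]; ring

lemma sum_mul_conformalShift (a : Fin m → ℝ) (i j : Fin m) :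
    ∑ l, a l * conformalShift g p P l i j = g i j * ∑ l, a l * P l - a j * p i - a i * p j := by
  simp [conformalShift, mul_sub, Finset.sum_sub_distrib, Finset.mul_sum, mul_left_comm]

/-- The quadratic part of the Ricci curvature after a change of connection `Γ ↦ Γ + T`. -/
lemma quadratic_conformalShift (hg : ∀ i j, g i j = g j i)
    (hgP : ∀ i, ∑ k, g i k * P k = p i) {Γ : Fin m → Fin m → Fin m → ℝ}
    (hΓ : ∀ k i j, Γ k i j = Γ k j i) (i j : Fin m) :
    ∑ k, ∑ l, ((Γ k k l + conformalShift g p P k k l) * (Γ l i j + conformalShift g p P l i j)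
        - (Γ k j l + conformalShift g p P k j l) * (Γ l i k + conformalShift g p P l i k))
      = ∑ k, ∑ l, (Γ k k l * Γ l i j - Γ k j l * Γ l i k)
        + ((2 - m) * ∑ l, Γ l i j * p l + g i j * ∑ k, ∑ l, Γ k k l * P l
          - ∑ k, (∑ l, (g l j * Γ l k i + g i l * Γ l k j)) * P k
          + (m - 2) * (p i * p j) - (m - 2) * (g i j * ∑ k, P k * p k)) := by
  set T := conformalShift g p P with hT
  have hgP' : ∀ i, ∑ k, P k * g i k = p i := fun i => by simp only [← hgP i, mul_comm]
  have t0 : ∀ l, ∑ k, T k k l = -m * p l := fun l => by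
    simp only [hT, fun k => conformalShift_comm (p := p) (P := P) hg k k l]
    exact sum_conformalShift hgP l
  have t1 : ∑ k, ∑ l, Γ k k l * T l i j
      = g i j * ∑ k, ∑ l, Γ k k l * P l - (∑ k, Γ k k j) * p i - (∑ k, Γ k k i) * p j := by
    simp only [hT, sum_mul_conformalShift, Finset.sum_sub_distrib, Finset.mul_sum, Finset.sum_mul]
  have t2 : ∑ k, ∑ l, T k k l * Γ l i j = -m * ∑ l, Γ l i j * p l := by
    rw [Finset.sum_comm]
    simp only [← Finset.sum_mul, t0, Finset.mul_sum]
    exact Finset.sum_congr rfl fun _ _ => by ring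
  have t3 : ∑ k, ∑ l, T k k l * T l i j
      = -m * (g i j * ∑ k, P k * p k) + 2 * m * (p i * p j) := by
    rw [Finset.sum_comm]
    simp only [← Finset.sum_mul, t0]
    rw [hT, sum_mul_conformalShift]
    have : ∑ l, -m * p l * P l = -m * ∑ k, P k * p k := by
      rw [Finset.mul_sum]; exact Finset.sum_congr rfl fun _ _ => by ring
    rw [this]; ring
  have t4 : ∑ k, ∑ l, Γ k j l * T l i k
      = ∑ k, ∑ l, g i l * Γ l k j * P k - (∑ k, Γ k k j) * p i - ∑ l, Γ l i j * p l := by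
    simp only [hT, sum_mul_conformalShift, Finset.sum_sub_distrib]
    congr 1
    · congr 1
      · simp only [Finset.mul_sum]
        rw [Finset.sum_comm]
        exact Finset.sum_congr rfl fun a _ => Finset.sum_congr rfl fun b _ => by
          rw [hΓ b j a]; ring
      · rw [Finset.sum_mul]
        exact Finset.sum_congr rfl fun a _ => by rw [hΓ a j a]
    · exact Finset.sum_congr rfl fun a _ => by rw [hΓ a j i]
  have t5 : ∑ k, ∑ l, T k j l * Γ l i k
      = ∑ k, ∑ l, g l j * Γ l k i * P k - (∑ k, Γ k k i) * p j - ∑ l, Γ l i j * p l := by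
    rw [Finset.sum_comm]
    have : ∀ l, ∑ k, T k j l * Γ l i k
        = g j l * ∑ k, Γ l i k * P k - Γ l i l * p j - Γ l i j * p l := fun l => by
      rw [← sum_mul_conformalShift]
      exact Finset.sum_congr rfl fun _ _ => mul_comm _ _
    simp only [this, Finset.sum_sub_distrib]
    congr 1
    congr 1
    · simp only [Finset.mul_sum]
      rw [Finset.sum_comm]
      exact Finset.sum_congr rfl fun a _ => Finset.sum_congr rfl fun b _ => by
        rw [hΓ b i a, hg j b]; ring
    · rw [Finset.sum_mul]
      exact Finset.sum_congr rfl fun a _ => by rw [hΓ a i a]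
  have t6 : ∑ k, ∑ l, T k j l * T l i k
      = (m + 2) * (p i * p j) - 2 * (g i j * ∑ k, P k * p k) := by
    have h1 : ∀ k, ∑ l, T k j l * T l i k = g i k * ∑ l, T k j l * P l
        - T k j k * p i - T k j i * p k := fun k => by
      rw [hT, sum_mul_conformalShift]
    have h2 : ∀ k, ∑ l, T k j l * P l
        = p j * P k - P k * p j - (if k = j then ∑ l, P l * p l else 0) := fun k => by
      simp only [hT, conformalShift, sub_mul, Finset.sum_sub_distrib, ite_mul, zero_mul]
      congr 1
      · congr 1
        · rw [← hgP j, Finset.sum_mul]; exact Finset.sum_congr rfl fun _ _ => by ring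
        · simp [mul_comm]
      · split_ifs <;> simp [mul_comm]
    have h3 : ∑ k, T k j i * p k = g i j * ∑ k, P k * p k - p j * p i - p i * p j := by
      simp only [hT, conformalShift, sub_mul, Finset.sum_sub_distrib, Finset.mul_sum, hg j i]
      simp [mul_assoc]
    have h4 : ∑ k, T k j k = -m * p j := sum_conformalShift hgP j
    simp only [h1, h2, Finset.sum_sub_distrib, h3, ← Finset.sum_mul, h4]
    simp [mul_comm (p j)]
    ring
  have t7 : ∑ k, (∑ l, (g l j * Γ l k i + g i l * Γ l k j)) * P k
      = ∑ k, ∑ l, g l j * Γ l k i * P k + ∑ k, ∑ l, g i l * Γ l k j * P k := by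
    simp only [Finset.sum_mul, add_mul, Finset.sum_add_distrib]
  simp only [add_mul, mul_add, Finset.sum_add_distrib, Finset.sum_sub_distrib]
  simp only [add_mul, Finset.sum_add_distrib] at t7
  rw [t1, t2, t3, t4, t5, t6, t7]
  ring

end Algebra

end ConformalChange

section ConformalMetric

variable {m : ℕ} {v : EuclideanSpace ℝ (Fin m) → ℝ} {y : EuclideanSpace ℝ (Fin m)}
  {G : EuclideanSpace ℝ (Fin m) → Matrix (Fin m) (Fin m) ℝ} {U : Set (EuclideanSpace ℝ (Fin m))}

namespace IsC2MetricOn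

lemma inv_conformal (hG : IsC2MetricOn G U) (hy : y ∈ U) (hv0 : v y ≠ 0) :
    ((v y ^ 2)⁻¹ • G y)⁻¹ = v y ^ 2 • (G y)⁻¹ := by
  refine Matrix.inv_eq_left_inv ?_
  rw [Matrix.smul_mul, Matrix.mul_smul, Matrix.nonsing_inv_mul _ (hG.isUnit_det hy), smul_smul,
    mul_inv_cancel₀ (pow_ne_zero 2 hv0), one_smul]

/-- The Christoffel symbols of `v⁻² G`. -/
lemma christoffel_conformal (hG : IsC2MetricOn G U) (hy : y ∈ U) (hv : DifferentiableAt ℝ v y)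
    (hv0 : v y ≠ 0) (k i j : Fin m) :
    christoffelSymbol (fun z => (v z ^ 2)⁻¹ • G z) k i j y = christoffelSymbol G k i j y
      + conformalShift (G y) (fun a => coordPartial a v y / v y)
          (fun a => coordGradient G v a y / v y) k i j := by
  have hd : ∀ a b c, coordPartial a (fun z => ((v z ^ 2)⁻¹ • G z) b c) y
      = (v y ^ 2)⁻¹ * (coordPartial a (fun z => G z b c) y
        - 2 * (coordPartial a v y / v y) * G y b c) := by
    intro a b c
    have h1 : DifferentiableAt ℝ (fun z => G z b c) y :=
      (hG.contDiffAt y hy b c).differentiableAt (by norm_num)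
    have h2 : DifferentiableAt ℝ (fun z => (v z ^ 2)⁻¹) y :=
      (hv.fun_pow 2).fun_inv (pow_ne_zero 2 hv0)
    have h3 : coordPartial a (fun z => (v z ^ 2)⁻¹) y
        = -2 * (v y ^ 2)⁻¹ * (coordPartial a v y / v y) := by
      rw [coordPartial_inv (hv.fun_pow 2) (pow_ne_zero 2 hv0)]
      simp only [pow_two]
      rw [coordPartial_mul hv hv]
      field_simp
      ring
    simp only [Matrix.smul_apply, smul_eq_mul]
    rw [coordPartial_mul h2 h1, h3]
    ring
  have hinv := hG.inv_conformal hy hv0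
  have hw : v y ^ 2 * (v y ^ 2)⁻¹ = 1 := mul_inv_cancel₀ (pow_ne_zero 2 hv0)
  rw [christoffelSymbol]
  simp only [hd]
  rw [hinv]
  simp only [Matrix.smul_apply, smul_eq_mul]
  have hterm : ∀ l, v y ^ 2 * (G y)⁻¹ k l *
      ((v y ^ 2)⁻¹ * (coordPartial i (fun z => G z j l) y
        - 2 * (coordPartial i v y / v y) * G y j l)
      + (v y ^ 2)⁻¹ * (coordPartial j (fun z => G z i l) y
        - 2 * (coordPartial j v y / v y) * G y i l)
      - (v y ^ 2)⁻¹ * (coordPartial l (fun z => G z i j) y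
        - 2 * (coordPartial l v y / v y) * G y i j))
      = (G y)⁻¹ k l * (coordPartial i (fun z => G z j l) y + coordPartial j (fun z => G z i l) y
        - coordPartial l (fun z => G z i j) y)
        + 2 * (G y i j * ((G y)⁻¹ k l * coordPartial l v y / v y)
          - (G y)⁻¹ k l * G y l j * (coordPartial i v y / v y)
          - (G y)⁻¹ k l * G y l i * (coordPartial j v y / v y)) := by
    intro l
    rw [hG.apply_comm hy j l, hG.apply_comm hy i l]
    linear_combination ((G y)⁻¹ k l * ((coordPartial i (fun z => G z j l) y
      - 2 * (coordPartial i v y / v y) * G y l j) + (coordPartial j (fun z => G z i l) y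
      - 2 * (coordPartial j v y / v y) * G y l i) - (coordPartial l (fun z => G z i j) y
        - 2 * (coordPartial l v y / v y) * G y i j))) * hw
  simp only [hterm, Finset.sum_add_distrib, ← Finset.mul_sum, Finset.sum_sub_distrib,
    ← Finset.sum_mul, ← Finset.sum_div, hG.sum_inv_mul hy, conformalShift, coordGradient]
  simp only [christoffelSymbol, ite_mul, one_mul, zero_mul]
  ring

/-- The conformal transformation law of the Ricci tensor: with `m` the dimension,
`Ric(v⁻² G) = Ric(G) + (m - 2) ∇²v / v + (Δv / v - (m - 1) |dv|² / v²) G`. -/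
theorem coordRicci_conformal (hG : IsC2MetricOn G U) (hv : ∀ z ∈ U, ContDiffAt ℝ 3 v z)
    (hv0 : ∀ z ∈ U, v z ≠ 0) (hy : y ∈ U) (i j : Fin m) :
    coordRicci (fun z => (v z ^ 2)⁻¹ • G z) i j y
      = coordRicci G i j y + (m - 2) * (coordHessian G v i j y / v y)
        + (coordLaplacian G v y / v y - (m - 1) * (coordNormSqDiff G v y / v y ^ 2)) * G y i j := by
  set p : Fin m → EuclideanSpace ℝ (Fin m) → ℝ := fun a z => coordPartial a v z / v z with hp
  set P : Fin m → EuclideanSpace ℝ (Fin m) → ℝ := fun a z => coordGradient G v a z / v z with hP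
  have hvy := hv0 y hy
  have hvd : DifferentiableAt ℝ v y := (hv y hy).differentiableAt (by norm_num)
  have hdiv : ∀ (w : EuclideanSpace ℝ (Fin m) → ℝ), DifferentiableAt ℝ w y → ∀ a,
      coordPartial a (fun z => w z / v z) y
        = coordPartial a w y / v y - w y / v y * p a y :=
    fun w hw a => coordPartial_div hw hvd hvy a
  have hdv : ∀ a, DifferentiableAt ℝ (coordPartial a v) y := fun a =>
    ((hv y hy).coordPartial (k := 2) (by norm_num) a).differentiableAt (by norm_num)
  have hdV : ∀ a, DifferentiableAt ℝ (coordGradient G v a) y := fun a =>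
    (hG.contDiffAt_coordGradient hy (hv y hy) a).differentiableAt (by norm_num)
  have hpd : ∀ a, DifferentiableAt ℝ (p a) y := fun a => (hdv a).mul (hvd.inv hvy)
  have hPd : ∀ a, DifferentiableAt ℝ (P a) y := fun a => (hdV a).mul (hvd.inv hvy)
  have hGd : ∀ a b, DifferentiableAt ℝ (fun z => G z a b) y := fun a b =>
    (hG.contDiffAt y hy a b).differentiableAt (by norm_num)
  have hΓd : ∀ k a b, DifferentiableAt ℝ (christoffelSymbol G k a b) y := fun k a b =>
    (hG.contDiffAt_christoffel hy k a b).differentiableAt one_ne_zero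
  let T : Fin m → Fin m → Fin m → EuclideanSpace ℝ (Fin m) → ℝ := fun k a b z =>
    conformalShift (G z) (fun c => p c z) (fun c => P c z) k a b
  have hGP : ∀ z ∈ U, ∀ a, ∑ k, G z a k * P k z = p a z := fun z hz a => by
    simp only [hP, hp, ← mul_div_assoc, ← Finset.sum_div, hG.sum_metric_mul_coordGradient hz]
  have hΓ : ∀ k a b, ∀ z ∈ U, christoffelSymbol (fun z => (v z ^ 2)⁻¹ • G z) k a b z
      = christoffelSymbol G k a b z + T k a b z := fun k a b z hz =>
    hG.christoffel_conformal hz ((hv z hz).differentiableAt (by norm_num)) (hv0 z hz) k a b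
  have hitd : ∀ (k a b : Fin m),
      DifferentiableAt ℝ (fun z => if k = a then p b z else 0) y := fun k a b => by
    split_ifs
    exacts [hpd b, differentiableAt_const 0]
  have hTd : ∀ k a b, DifferentiableAt ℝ (T k a b) y := fun k a b =>
    (((hGd a b).fun_mul (hPd k)).fun_sub (hitd k b a)).fun_sub (hitd k a b)
  have hdΓ : ∀ c k a b, coordPartial c (christoffelSymbol (fun z => (v z ^ 2)⁻¹ • G z) k a b) y
      = coordPartial c (christoffelSymbol G k a b) y + coordPartial c (T k a b) y :=
    fun c k a b => by
      rw [← coordPartial_add (hΓd k a b) (hTd k a b)]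
      exact coordPartial_congr ((hG.eventually_mem hy).mono (hΓ k a b)) c
  have hit : ∀ (c k a b : Fin m), coordPartial c (fun z => if k = a then p b z else 0) y
      = if k = a then coordPartial c (p b) y else 0 := fun c k a b => by
    split_ifs
    exacts [rfl, coordPartial_const 0 c]
  have hdT : ∀ c k a b, coordPartial c (T k a b) y
      = coordPartial c (fun z => G z a b) y * P k y + G y a b * coordPartial c (P k) y
        - (if k = b then coordPartial c (p a) y else 0)
        - (if k = a then coordPartial c (p b) y else 0) := fun c k a b => by
    rw [← hit, ← hit, ← coordPartial_mul (hGd a b) (hPd k),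
      ← coordPartial_sub ((hGd a b).fun_mul (hPd k)) (hitd k b a),
      ← coordPartial_sub (((hGd a b).fun_mul (hPd k)).fun_sub (hitd k b a)) (hitd k a b)]
    rfl
  -- the divergence of `T`
  have hd1 : ∑ k, coordPartial k (T k i j) y
      = ∑ k, (∑ l, (G y l j * christoffelSymbol G l k i y
          + G y i l * christoffelSymbol G l k j y)) * P k y
        + G y i j * ∑ k, coordPartial k (P k) y - coordPartial j (p i) y
        - coordPartial i (p j) y := by
    simp only [hdT, Finset.sum_sub_distrib, Finset.sum_add_distrib (f := fun k => _ * P k y),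
      hG.coordPartial_metric hy _ i j, Finset.mul_sum]
    simp
  -- the derivative of the trace of `T`
  have hd2 : ∑ k, coordPartial j (T k i k) y = -m * coordPartial j (p i) y := by
    rw [← coordPartial_sum _ (fun k _ => hTd k i k), ← coordPartial_const_mul (hpd i)]
    exact coordPartial_congr ((hG.eventually_mem hy).mono fun z hz =>
      sum_conformalShift (hGP z hz) i) j
  have hquad := quadratic_conformalShift (g := G y) (p := fun c => p c y) (P := fun c => P c y)
    (hG.apply_comm hy) (hGP y hy) (Γ := fun k a b => christoffelSymbol G k a b y)
    (fun k a b => hG.christoffel_comm hy k a b) i j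
  -- `∇p = ∇²v / v - p ⊗ p`
  have hdp : ∀ a b, coordPartial a (p b) y
      = coordHessian G v a b y / v y + ∑ l, christoffelSymbol G l a b y * p l y - p b y * p a y :=
    fun a b => by
      rw [hp, hdiv _ (hdv b) a]
      simp only [coordHessian, ← mul_div_assoc, ← Finset.sum_div]
      simp only [hp]
      ring
  have hdP : ∑ k, coordPartial k (P k) y
      + ∑ k, ∑ l, christoffelSymbol G k k l y * P l y
      = coordLaplacian G v y / v y - ∑ k, P k y * p k y := by
    rw [← hG.divergence_coordGradient hy ((hv y hy).of_le (by norm_num)), ← Finset.sum_add_distrib,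
      Finset.sum_div, ← Finset.sum_sub_distrib]
    refine Finset.sum_congr rfl fun k _ => ?_
    rw [hP, hdiv _ (hdV k) k]
    simp only [← mul_div_assoc, ← Finset.sum_div]
    ring
  have hnorm : ∑ k, P k y * p k y = coordNormSqDiff G v y / v y ^ 2 := by
    simp only [coordNormSqDiff, hP, hp, Finset.sum_div]
    exact Finset.sum_congr rfl fun _ _ => by field_simp
  have hΓ' : ∀ k a b, christoffelSymbol (fun z => (v z ^ 2)⁻¹ • G z) k a b y
      = christoffelSymbol G k a b y
        + conformalShift (G y) (fun c => p c y) (fun c => P c y) k a b := fun k a b =>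
    hΓ k a b y hy
  simp only [coordRicci, hdΓ, hΓ', hquad]
  simp only [Finset.sum_sub_distrib, Finset.sum_add_distrib (f := fun k => coordPartial _ _ y),
    hd1, hd2]
  rw [← hnorm]
  have hcomm : ∑ l, christoffelSymbol G l j i y * p l y
      = ∑ l, christoffelSymbol G l i j y * p l y :=
    Finset.sum_congr rfl fun l _ => by rw [hG.christoffel_comm hy l j i]
  rw [hdp i j, hdp j i, hG.coordHessian_comm hy ((hv y hy).of_le (by norm_num)) j i, hcomm]
  linear_combination (G y i j) * hdP

end IsC2MetricOn

end ConformalMetric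

/-! ### Second covariant derivatives -/

section BochnerFormula

variable {m : ℕ} {f : EuclideanSpace ℝ (Fin m) → ℝ} {y : EuclideanSpace ℝ (Fin m)}
  {G : EuclideanSpace ℝ (Fin m) → Matrix (Fin m) (Fin m) ℝ} {U : Set (EuclideanSpace ℝ (Fin m))}

/-- The covariant derivative `∇ᵢVʲ` of a vector field `V`. -/
noncomputable def coordCovariantDeriv (G : EuclideanSpace ℝ (Fin m) → Matrix (Fin m) (Fin m) ℝ)
    (V : Fin m → EuclideanSpace ℝ (Fin m) → ℝ) (i j : Fin m) (y : EuclideanSpace ℝ (Fin m)) : ℝ :=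
  coordPartial i (V j) y + ∑ l, christoffelSymbol G j i l y * V l y

namespace IsC2MetricOn

variable (hG : IsC2MetricOn G U) (hy : y ∈ U)
include hG hy

lemma coordPartial_coordNormSqDiff (hf : ContDiffAt ℝ 3 f y) (i : Fin m) :
    coordPartial i (coordNormSqDiff G f) y
      = 2 * ∑ l, coordGradient G f l y * coordHessian G f i l y := by
  have hV : ∀ k, DifferentiableAt ℝ (coordGradient G f k) y := fun k =>
    (hG.contDiffAt_coordGradient hy hf k).differentiableAt (by norm_num)
  have hd : ∀ k, DifferentiableAt ℝ (coordPartial k f) y := fun k =>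
    (hf.coordPartial (k := 2) (by norm_num) k).differentiableAt (by norm_num)
  have h1 : ∀ k, coordPartial i (coordGradient G f k) y = ∑ l, (G y)⁻¹ k l * coordHessian G f i l y
      - ∑ l, christoffelSymbol G k i l y * coordGradient G f l y := fun k =>
    eq_sub_of_add_eq (hG.covariantDerivative_coordGradient hy (hf.of_le (by norm_num)) i k)
  have h2 : ∀ k, coordPartial i (coordPartial k f) y
      = coordHessian G f i k y + ∑ l, christoffelSymbol G l i k y * coordPartial l f y :=
    fun k => (sub_add_cancel _ _).symm
  have e1 : ∑ k, (∑ l, (G y)⁻¹ k l * coordHessian G f i l y) * coordPartial k f y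
      = ∑ l, coordGradient G f l y * coordHessian G f i l y := by
    simp only [coordGradient, Finset.sum_mul]
    rw [Finset.sum_comm]
    exact Finset.sum_congr rfl fun a _ => Finset.sum_congr rfl fun b _ => by
      rw [hG.inv_comm hy a b]; ring
  have e2 : ∑ k, (∑ l, christoffelSymbol G k i l y * coordGradient G f l y) * coordPartial k f y
      = ∑ k, coordGradient G f k y * ∑ l, christoffelSymbol G l i k y * coordPartial l f y := by
    simp only [Finset.sum_mul, Finset.mul_sum]
    rw [Finset.sum_comm]
    exact Finset.sum_congr rfl fun a _ => Finset.sum_congr rfl fun b _ => by ring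
  have h3 : coordPartial i (coordNormSqDiff G f) y
      = ∑ k, (coordPartial i (coordGradient G f k) y * coordPartial k f y
        + coordGradient G f k y * coordPartial i (coordPartial k f) y) := by
    unfold coordNormSqDiff
    rw [coordPartial_sum (F := fun k z => coordGradient G f k z * coordPartial k f z) _
      fun k _ => (hV k).fun_mul (hd k)]
    exact Finset.sum_congr rfl fun k _ => coordPartial_mul (hV k) (hd k) i
  rw [h3]
  simp only [h1, h2, sub_mul, mul_add, Finset.sum_add_distrib, Finset.sum_sub_distrib, e1, e2]
  ring

lemma contDiffAt_coordCovariantDeriv {V : Fin m → EuclideanSpace ℝ (Fin m) → ℝ}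
    (hV : ∀ k, ContDiffAt ℝ 2 (V k) y) (i j : Fin m) :
    ContDiffAt ℝ 1 (coordCovariantDeriv G V i j) y :=
  ((hV j).coordPartial (by norm_num) i).add (ContDiffAt.sum fun l _ =>
    (hG.contDiffAt_christoffel hy j i l).mul ((hV l).of_le (by norm_num)))

/-- The contracted Ricci identity `∇ⱼ∇ᵢVʲ = ∇ᵢ∇ⱼVʲ + Rₗᵢ Vˡ`. -/
lemma divergence_coordCovariantDeriv {V : Fin m → EuclideanSpace ℝ (Fin m) → ℝ}
    (hV : ∀ k, ContDiffAt ℝ 2 (V k) y) (i : Fin m) :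
    ∑ j, coordPartial j (coordCovariantDeriv G V i j) y
        + ∑ j, ∑ l, christoffelSymbol G j j l y * coordCovariantDeriv G V i l y
        - ∑ j, ∑ l, christoffelSymbol G l j i y * coordCovariantDeriv G V l j y
      = coordPartial i (fun z => ∑ j, coordCovariantDeriv G V j j z) y
        + ∑ l, coordRicci G l i y * V l y := by
  have hVd : ∀ k, DifferentiableAt ℝ (V k) y := fun k => (hV k).differentiableAt (by norm_num)
  have hdV : ∀ a k, DifferentiableAt ℝ (coordPartial a (V k)) y := fun a k =>
    ((hV k).coordPartial (k := 1) (by norm_num) a).differentiableAt one_ne_zero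
  have hΓd : ∀ k a b, DifferentiableAt ℝ (christoffelSymbol G k a b) y := fun k a b =>
    (hG.contDiffAt_christoffel hy k a b).differentiableAt one_ne_zero
  have hA : ∀ a b, DifferentiableAt ℝ (coordCovariantDeriv G V a b) y := fun a b =>
    (hG.contDiffAt_coordCovariantDeriv hy hV a b).differentiableAt one_ne_zero
  have hdA : ∀ c a b, coordPartial c (coordCovariantDeriv G V a b) y
      = coordPartial c (coordPartial a (V b)) y
        + (∑ l, coordPartial c (christoffelSymbol G b a l) y * V l y
        + ∑ l, christoffelSymbol G b a l y * coordPartial c (V l) y) := by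
    intro c a b
    have hs : ∀ l ∈ Finset.univ,
        DifferentiableAt ℝ (fun z => christoffelSymbol G b a l z * V l z) y :=
      fun l _ => (hΓd b a l).fun_mul (hVd l)
    unfold coordCovariantDeriv
    rw [coordPartial_add (h := fun z => ∑ l, christoffelSymbol G b a l z * V l z) (hdV a b)
      (DifferentiableAt.fun_sum hs),
      coordPartial_sum (F := fun l z => christoffelSymbol G b a l z * V l z) _ hs,
      ← Finset.sum_add_distrib]
    congr 1
    exact Finset.sum_congr rfl fun l _ => coordPartial_mul (hΓd b a l) (hVd l) c
  have hΓc := fun k a b => hG.christoffel_comm hy k a b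
  have hdΓc : ∀ c k a b, coordPartial c (christoffelSymbol G k a b) y
      = coordPartial c (christoffelSymbol G k b a) y := fun c k a b =>
    coordPartial_congr ((hG.eventually_mem hy).mono fun z hz => hG.christoffel_comm hz k a b) c
  have hc : ∀ j, coordPartial j (coordPartial i (V j)) y
      = coordPartial i (coordPartial j (V j)) y :=
    fun j => coordPartial_comm (hV j) j i
  rw [coordPartial_sum _ fun j _ => hA j j]
  simp only [hdA, coordCovariantDeriv, mul_add, Finset.sum_add_distrib, hc]
  have r1 : ∑ j, ∑ l, christoffelSymbol G j i l y * coordPartial j (V l) y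
      = ∑ j, ∑ l, christoffelSymbol G l j i y * coordPartial l (V j) y := by
    rw [Finset.sum_comm]
    exact Finset.sum_congr rfl fun a _ => Finset.sum_congr rfl fun b _ => by rw [hΓc b i a]
  have r2 : ∑ l, coordRicci G l i y * V l y
      = ∑ j, ∑ l, coordPartial j (christoffelSymbol G j i l) y * V l y
        - ∑ j, ∑ l, coordPartial i (christoffelSymbol G j j l) y * V l y
        + ∑ j, ∑ l, christoffelSymbol G j j l y * ∑ k, christoffelSymbol G l i k y * V k y
        - ∑ j, ∑ l, christoffelSymbol G l j i y * ∑ k, christoffelSymbol G j l k y * V k y := by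
    simp only [coordRicci, Finset.sum_sub_distrib, add_mul, sub_mul, Finset.sum_add_distrib,
      Finset.sum_mul, Finset.mul_sum]
    have s1 : ∑ l, ∑ k, coordPartial k (christoffelSymbol G k l i) y * V l y
        = ∑ j, ∑ l, coordPartial j (christoffelSymbol G j i l) y * V l y := by
      rw [Finset.sum_comm]
      exact Finset.sum_congr rfl fun a _ => Finset.sum_congr rfl fun b _ => by rw [hdΓc a a b i]
    have s2 : ∑ l, ∑ k, coordPartial i (christoffelSymbol G k l k) y * V l y
        = ∑ j, ∑ l, coordPartial i (christoffelSymbol G j j l) y * V l y := by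
      rw [Finset.sum_comm]
      exact Finset.sum_congr rfl fun a _ => Finset.sum_congr rfl fun b _ => by rw [hdΓc i a b a]
    have s3 : ∑ l, ∑ k, ∑ p, christoffelSymbol G k k p y * christoffelSymbol G p l i y * V l y
        = ∑ j, ∑ l, ∑ k, christoffelSymbol G j j l y * (christoffelSymbol G l i k y * V k y) := by
      rw [Finset.sum_comm]
      refine Finset.sum_congr rfl fun a _ => ?_
      rw [Finset.sum_comm]
      exact Finset.sum_congr rfl fun b _ => Finset.sum_congr rfl fun c _ => by
        rw [hΓc b c i]; ring
    have s4 : ∑ l, ∑ k, ∑ p, christoffelSymbol G k i p y * christoffelSymbol G p l k y * V l y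
        = ∑ j, ∑ l, ∑ k, christoffelSymbol G l j i y * (christoffelSymbol G j l k y * V k y) := by
      rw [Finset.sum_comm]
      conv_rhs => rw [Finset.sum_comm]
      refine Finset.sum_congr rfl fun a _ => ?_
      rw [Finset.sum_comm]
      exact Finset.sum_congr rfl fun b _ => Finset.sum_congr rfl fun c _ => by
        rw [hΓc b c a, hΓc a b i]; ring
    rw [s1, s2, s3, s4]
    ring
  rw [r1, r2]
  ring

end IsC2MetricOn

end BochnerFormula

/-! ### Eigenfunctions of Einstein metrics -/

section Eigenfunction

variable {m : ℕ} {v : EuclideanSpace ℝ (Fin m) → ℝ} {y : EuclideanSpace ℝ (Fin m)}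
  {G : EuclideanSpace ℝ (Fin m) → Matrix (Fin m) (Fin m) ℝ} {U : Set (EuclideanSpace ℝ (Fin m))}

open scoped MatrixOrder in
/-- `|b|² = tr (b K b K)` is a norm on symmetric matrices when `K` is positive definite. -/
lemma Matrix.PosDef.eq_zero_of_trace_mul_mul_mul_eq_zero {ι : Type*} [Fintype ι] [DecidableEq ι]
    {K b : Matrix ι ι ℝ} (hK : K.PosDef) (hb : b.transpose = b)
    (h : (b * K * (b * K)).trace = 0) : b = 0 := by
  obtain ⟨C, hC, rfl⟩ := CStarAlgebra.isStrictlyPositive_iff_eq_star_mul_self.mp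
    hK.isStrictlyPositive
  rw [Matrix.star_eq_conjTranspose, Matrix.conjTranspose_eq_transpose_of_trivial] at h
  have hS : C * b * C.transpose = 0 := by
    rw [← Matrix.trace_conjTranspose_mul_self_eq_zero_iff (A := C * b * C.transpose), ← h,
      Matrix.conjTranspose_eq_transpose_of_trivial, Matrix.transpose_mul, Matrix.transpose_mul,
      Matrix.transpose_transpose, hb, Matrix.trace_mul_comm (b * _)]
    simp only [← Matrix.mul_assoc]
    rw [Matrix.trace_mul_comm]
    simp only [← Matrix.mul_assoc]
    rw [Matrix.trace_mul_comm]
    simp only [← Matrix.mul_assoc]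
  have hdet := (Matrix.isUnit_iff_isUnit_det C).mp hC
  have hdet' : IsUnit C.transpose.det := by rwa [Matrix.det_transpose]
  calc b = C⁻¹ * (C * b * C.transpose) * C.transpose⁻¹ := by
        rw [Matrix.mul_assoc C b, Matrix.nonsing_inv_mul_cancel_left _ _ hdet,
          Matrix.mul_nonsing_inv_cancel_right _ _ hdet']
    _ = 0 := by rw [hS, Matrix.mul_zero, Matrix.zero_mul]

/-- A metric `G` on `U` with `Ric = -(m - 1) G` and a positive `C³` solution `v` of `Δv = m v`. -/
structure IsEinsteinEigenpairOn (G : EuclideanSpace ℝ (Fin m) → Matrix (Fin m) (Fin m) ℝ)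
    (v : EuclideanSpace ℝ (Fin m) → ℝ) (U : Set (EuclideanSpace ℝ (Fin m))) : Prop where
  metric : IsC2MetricOn G U
  einstein : ∀ y ∈ U, ∀ i j, coordRicci G i j y = -((m : ℝ) - 1) * G y i j
  contDiffAt : ∀ y ∈ U, ContDiffAt ℝ 3 v y
  pos : ∀ y ∈ U, 0 < v y
  eigen : ∀ y ∈ U, coordLaplacian G v y = m * v y

namespace IsEinsteinEigenpairOn

variable (h : IsEinsteinEigenpairOn G v U) (hy : y ∈ U)
include h hy

lemma coordRicci_conformal (i j : Fin m) :
    coordRicci (fun z => (v z ^ 2)⁻¹ • G z) i j y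
      = (m - 2) * (coordHessian G v i j y / v y)
        + (1 - (m - 1) * (coordNormSqDiff G v y / v y ^ 2)) * G y i j := by
  rw [h.metric.coordRicci_conformal h.contDiffAt (fun z hz => (h.pos z hz).ne') hy,
    h.einstein y hy, h.eigen y hy, mul_div_cancel_right₀ _ (h.pos y hy).ne']
  ring

/-- The scalar curvature of `v⁻² G` is `m (m - 1) (v² - |dv|²)`. -/
lemma coordScalar_conformal :
    coordScalar (fun z => (v z ^ 2)⁻¹ • G z) y
      = m * (m - 1) * (v y ^ 2 - coordNormSqDiff G v y) := by
  have hv0 := (h.pos y hy).ne'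
  have hinv := h.metric.inv_conformal hy hv0
  have htr : ∑ i, ∑ j, (G y)⁻¹ i j * G y i j = m := by
    have hone : ∀ i, ∑ j, (G y)⁻¹ i j * G y i j = 1 := fun i => by
      rw [← if_pos (rfl : i = i) (t := (1 : ℝ)) (e := 0), ← h.metric.sum_inv_mul hy i i]
      exact Finset.sum_congr rfl fun j _ => by rw [h.metric.apply_comm hy i j]
    simp [hone]
  have hL := h.eigen y hy
  rw [coordLaplacian] at hL
  rw [coordScalar]
  simp only [hinv, h.coordRicci_conformal hy, Matrix.smul_apply, smul_eq_mul]
  calc _ = ∑ i, ∑ j, (v y * (m - 2) * ((G y)⁻¹ i j * coordHessian G v i j y)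
      + (v y ^ 2 - (m - 1) * coordNormSqDiff G v y) * ((G y)⁻¹ i j * G y i j)) := by
        refine Finset.sum_congr rfl fun i _ => Finset.sum_congr rfl fun j _ => ?_
        field_simp
    _ = _ := by
        simp only [Finset.sum_add_distrib, ← Finset.mul_sum, hL, htr]
        ring

/-- The trace-free Ricci tensor of `v⁻² G` is `(m - 2) (∇²v - v G) / v`. -/
theorem coordTraceFreeRicci_conformal (i j : Fin m) :
    coordTraceFreeRicci (fun z => (v z ^ 2)⁻¹ • G z) i j y
      = (m - 2) / v y * (coordHessian G v i j y - v y * G y i j) := by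
  have hv0 := (h.pos y hy).ne'
  have hm : (m : ℝ) ≠ 0 := by
    have := i.pos
    positivity
  rw [coordTraceFreeRicci, h.coordScalar_conformal hy, h.coordRicci_conformal hy,
    Matrix.smul_apply, smul_eq_mul]
  field_simp
  ring

lemma differentiableAt_coordNormSqDiff : DifferentiableAt ℝ (coordNormSqDiff G v) y :=
  have hv := h.contDiffAt y hy
  DifferentiableAt.fun_sum fun k _ => ((h.metric.contDiffAt_coordGradient hy hv
    k).differentiableAt (by norm_num)).fun_mul
      ((hv.coordPartial (k := 2) (by norm_num) k).differentiableAt (by norm_num))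

lemma differentiableAt_sq_sub_coordNormSqDiff :
    DifferentiableAt ℝ (fun z => v z ^ 2 - coordNormSqDiff G v z) y :=
  (((h.contDiffAt y hy).differentiableAt (by norm_num)).fun_pow 2).fun_sub
    (h.differentiableAt_coordNormSqDiff hy)

/-- `d(v² - |dv|²) = -2 b(∇v, ·)` for `b = ∇²v - v G`. -/
lemma coordPartial_sq_sub_coordNormSqDiff (i : Fin m) :
    coordPartial i (fun z => v z ^ 2 - coordNormSqDiff G v z) y
      = -2 * ∑ l, coordGradient G v l y * (coordHessian G v i l y - v y * G y i l) := by
  have hv := h.contDiffAt y hy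
  have hvd : DifferentiableAt ℝ v y := hv.differentiableAt (by norm_num)
  have hG := h.metric.sum_metric_mul_coordGradient hy (f := v) i
  rw [coordPartial_sub (hvd.fun_pow 2) (h.differentiableAt_coordNormSqDiff hy),
    h.metric.coordPartial_coordNormSqDiff hy hv]
  simp only [pow_two]
  rw [coordPartial_mul hvd hvd, ← hG]
  simp only [mul_sub, Finset.sum_sub_distrib]
  have : ∑ l, coordGradient G v l y * (v y * G y i l)
      = v y * ∑ k, G y i k * coordGradient G v k y := by
    rw [Finset.mul_sum]; exact Finset.sum_congr rfl fun _ _ => by ring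
  rw [this]; ring

lemma fderiv_sq_sub_coordNormSqDiff
    (hb : ∀ i j, coordHessian G v i j y = v y * G y i j) :
    fderiv ℝ (fun z => v z ^ 2 - coordNormSqDiff G v z) y = 0 := by
  have hi : ∀ i, coordPartial i (fun z => v z ^ 2 - coordNormSqDiff G v z) y = 0 := fun i => by
    simp [h.coordPartial_sq_sub_coordNormSqDiff hy, hb]
  ext w
  rw [sum_smul_single w, map_sum]
  simp only [map_smul]
  exact Finset.sum_eq_zero fun i _ => by
    have := hi i
    rw [coordPartial] at this
    simp [this]

/-- In dimension one the trace-free symmetric tensor `∇²v - v G` vanishes identically. -/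
lemma coordHessian_eq_of_dim_eq_one (hm : m = 1) (i j : Fin m) :
    coordHessian G v i j y = v y * G y i j := by
  subst hm
  have h1 := h.eigen y hy
  have h2 := h.metric.sum_inv_mul hy 0 0
  simp only [coordLaplacian, Finset.univ_unique, Fin.default_eq_zero, Finset.sum_singleton,
    Subsingleton.elim i 0, Subsingleton.elim j 0, if_true, Nat.cast_one, one_mul] at h1 h2 ⊢
  linear_combination G y 0 0 * h1 - coordHessian G v 0 0 y * h2

/-- If `v² - |dv|²` is constant near `y`, then `b = ∇²v - v G` vanishes at `y`: the vector field
`∇v` is annihilated by `b`, and the divergence of `b(∇v)` is `|b|²`. -/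
theorem coordHessian_eq_of_eventually_const {c : ℝ}
    (hc : ∀ᶠ z in 𝓝 y, v z ^ 2 - coordNormSqDiff G v z = c) (i j : Fin m) :
    coordHessian G v i j y = v y * G y i j := by
  have hG := h.metric
  have hv := h.contDiffAt y hy
  have hvd : DifferentiableAt ℝ v y := hv.differentiableAt (by norm_num)
  set V := coordGradient G v with hV
  set A := coordCovariantDeriv G V with hA
  have hV2 : ∀ k, ContDiffAt ℝ 2 (V k) y := hG.contDiffAt_coordGradient hy hv
  have hVd : ∀ k, DifferentiableAt ℝ (V k) y := fun k => (hV2 k).differentiableAt (by norm_num)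
  have hAd : ∀ a b, DifferentiableAt ℝ (A a b) y := fun a b =>
    (hG.contDiffAt_coordCovariantDeriv hy hV2 a b).differentiableAt one_ne_zero
  have hAH : ∀ z ∈ U, ∀ a b, A a b z = ∑ l, (G z)⁻¹ b l * coordHessian G v a l z :=
    fun z hz a b => hG.covariantDerivative_coordGradient hz
      ((h.contDiffAt z hz).of_le (by norm_num)) a b
  have hAtr : ∀ z ∈ U, ∑ k, A k k z = m * v z := fun z hz => by
    rw [← h.eigen z hz, ← hG.divergence_coordGradient hz ((h.contDiffAt z hz).of_le (by norm_num))]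
    rfl
  -- `∇v` is an eigenvector of `∇∇v` near `y`
  have hVA : ∀ᶠ z in 𝓝 y, ∀ a, ∑ k, V k z * A k a z = v z * V a z := by
    filter_upwards [hc.eventually_nhds, hG.eventually_mem hy] with z hz hzU a
    have hH : ∀ l, ∑ k, V k z * coordHessian G v k l z = v z * coordPartial l v z := fun l => by
      have h0 := h.coordPartial_sq_sub_coordNormSqDiff hzU l
      rw [coordPartial_congr hz, coordPartial_const] at h0
      have hs : ∑ k, coordGradient G v k z * (v z * G z l k) = v z * coordPartial l v z := by
        rw [← hG.sum_metric_mul_coordGradient hzU (f := v) l, Finset.mul_sum]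
        exact Finset.sum_congr rfl fun _ _ => by ring
      simp only [mul_sub, Finset.sum_sub_distrib, hs] at h0
      have hs' : ∑ k, V k z * coordHessian G v k l z = ∑ k, V k z * coordHessian G v l k z :=
        Finset.sum_congr rfl fun k _ => by
          rw [hG.coordHessian_comm hzU ((h.contDiffAt z hzU).of_le (by norm_num)) k l]
      rw [hs']
      linarith
    calc ∑ k, V k z * A k a z = ∑ l, (G z)⁻¹ a l * ∑ k, V k z * coordHessian G v k l z := by
          simp only [hAH z hzU, Finset.mul_sum]
          rw [Finset.sum_comm]
          exact Finset.sum_congr rfl fun _ _ => Finset.sum_congr rfl fun _ _ => by ring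
      _ = v z * V a z := by
          simp only [hH]
          simp only [hV, coordGradient, Finset.mul_sum]
          exact Finset.sum_congr rfl fun _ _ => by ring
  -- the divergence of both sides of that equation
  have hdiv : ∀ a, ∑ k, (coordPartial a (V k) y * A k a y + V k y * coordPartial a (A k a) y)
      = coordPartial a v y * V a y + v y * coordPartial a (V a) y := fun a => by
    rw [← coordPartial_mul hvd (hVd a), ← coordPartial_congr (hVA.mono fun z hz => hz a) a,
      coordPartial_sum (F := fun k z => V k z * A k a z) _ fun k _ => (hVd k).fun_mul (hAd k a)]
    exact Finset.sum_congr rfl fun k _ => (coordPartial_mul (hVd k) (hAd k a) a).symm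
  have hRicV : ∀ k, ∑ l, coordRicci G l k y * V l y = -((m : ℝ) - 1) * coordPartial k v y :=
    fun k => by
      simp only [h.einstein y hy, hV]
      rw [← hG.sum_metric_mul_coordGradient hy (f := v) k, Finset.mul_sum]
      exact Finset.sum_congr rfl fun l _ => by rw [hG.apply_comm hy l k]; ring
  have htr' : ∀ k, coordPartial k (fun z => ∑ j, A j j z) y = m * coordPartial k v y := fun k => by
    rw [coordPartial_congr ((hG.eventually_mem hy).mono hAtr), coordPartial_const_mul hvd]
  have hdA : ∀ k, ∑ a, coordPartial a (A k a) y = coordPartial k v y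
      - ∑ a, ∑ l, christoffelSymbol G a a l y * A k l y
      + ∑ a, ∑ l, christoffelSymbol G l a k y * A l a y := fun k => by
    have := hG.divergence_coordCovariantDeriv hy hV2 k
    rw [htr', hRicV] at this
    linarith
  have hdV : ∀ a k, coordPartial a (V k) y = A a k y - ∑ l, christoffelSymbol G k a l y * V l y :=
    fun a k => (add_sub_cancel_right _ _).symm
  have hVAy : ∀ a, ∑ k, V k y * A k a y = v y * V a y := hVA.self_of_nhds
  have hsum : ∑ a, ∑ k, A a k y * A k a y = m * v y ^ 2 := by
    have h1 := Finset.sum_congr (rfl : (Finset.univ : Finset (Fin m)) = _) fun a _ => hdiv a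
    simp only [Finset.sum_add_distrib] at h1
    rw [Finset.sum_comm (f := fun a k => V k y * coordPartial a (A k a) y)] at h1
    simp only [← Finset.mul_sum, hdA, hdV, sub_mul, mul_sub, mul_add, Finset.sum_sub_distrib,
      Finset.sum_add_distrib, hAtr y hy] at h1
    have g1 : ∑ a, ∑ k, (∑ l, christoffelSymbol G k a l y * V l y) * A k a y
        = ∑ k, V k y * ∑ a, ∑ l, christoffelSymbol G l a k y * A l a y := by
      simp only [Finset.sum_mul, Finset.mul_sum]
      conv_rhs => rw [Finset.sum_comm]
      refine Finset.sum_congr rfl fun a _ => ?_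
      rw [Finset.sum_comm]
      exact Finset.sum_congr rfl fun _ _ => Finset.sum_congr rfl fun _ _ => by ring
    have g2 : ∑ k, V k y * ∑ a, ∑ l, christoffelSymbol G a a l y * A k l y
        = v y * ∑ a, ∑ l, christoffelSymbol G a a l y * V l y := by
      have : ∀ a l, v y * (christoffelSymbol G a a l y * V l y)
          = ∑ k, V k y * (christoffelSymbol G a a l y * A k l y) := fun a l => by
        rw [mul_left_comm, ← hVAy l, Finset.mul_sum]
        exact Finset.sum_congr rfl fun _ _ => by ring
      simp only [Finset.mul_sum, this]
      rw [Finset.sum_comm]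
      exact Finset.sum_congr rfl fun _ _ => Finset.sum_comm
    have g3 : ∑ k, V k y * coordPartial k v y = ∑ k, coordPartial k v y * V k y :=
      Finset.sum_congr rfl fun _ _ => mul_comm _ _
    rw [g1, g2, g3] at h1
    linear_combination h1
  -- hence `|b|² = tr (∇∇v - v)² = 0`
  let b : Matrix (Fin m) (Fin m) ℝ :=
    Matrix.of (fun i j => coordHessian G v i j y) - v y • G y
  have hbA : b * (G y)⁻¹ = Matrix.of (fun i j => A i j y) - v y • 1 := by
    rw [Matrix.sub_mul, Matrix.smul_mul, Matrix.mul_nonsing_inv _ (hG.isUnit_det hy)]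
    congr 1
    ext i j
    rw [Matrix.mul_apply, Matrix.of_apply, hAH y hy]
    exact Finset.sum_congr rfl fun l _ => by rw [hG.inv_comm hy, mul_comm]; rfl
  have hbt : b.transpose = b := by
    ext i j
    simp [b, hG.coordHessian_comm hy (hv.of_le (by norm_num)) j i, hG.apply_comm hy j i]
  have htrA : (Matrix.of (fun i j => A i j y)).trace = m * v y := hAtr y hy
  have htrA2 : (Matrix.of (fun i j => A i j y) * Matrix.of (fun i j => A i j y)).trace
      = m * v y ^ 2 := by
    rw [← hsum]; simp [Matrix.trace, Matrix.mul_apply]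
  have hb0 : b = 0 := by
    refine (hG.posDef y hy).inv.eq_zero_of_trace_mul_mul_mul_eq_zero hbt ?_
    rw [hbA]
    simp only [Matrix.sub_mul, Matrix.mul_sub, Matrix.smul_mul, Matrix.mul_smul, Matrix.one_mul,
      Matrix.mul_one, Matrix.trace_sub, Matrix.trace_smul, htrA, htrA2, Matrix.trace_one,
      Fintype.card_fin, smul_eq_mul]
    ring
  have := congrFun (congrFun hb0 i) j
  simpa [b, sub_eq_zero] using this

end IsEinsteinEigenpairOn

end Eigenfunction

/-! ### Charts around interior points -/

section InteriorPoints

variable {n : ℕ} {X : Type*} [TopologicalSpace X]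
  {e : OpenPartialHomeomorph X (EuclideanHalfSpace (n + 1))} {x : X}
  {y : EuclideanSpace ℝ (Fin (n + 1))}

lemma symm_mem_source (hy : y ∈ interior (e.extend (𝓡∂ (n + 1))).target) :
    (e.extend (𝓡∂ (n + 1))).symm y ∈ e.source := by
  rw [← e.extend_source (I := 𝓡∂ (n + 1))]
  exact (e.extend (𝓡∂ (n + 1))).map_target (interior_subset hy)

lemma inChart_extend {u : X → ℝ} (hx : x ∈ e.source) :
    inChart e u (e.extend (𝓡∂ (n + 1)) x) = u x := by
  rw [inChart, Function.comp_apply, e.extend_left_inv hx]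

lemma extend_symm_eq (hy : y ∈ interior (e.extend (𝓡∂ (n + 1))).target) :
    e.extend (𝓡∂ (n + 1)) ((e.extend (𝓡∂ (n + 1))).symm y) = y :=
  (e.extend (𝓡∂ (n + 1))).right_inv (interior_subset hy)

variable [ChartedSpace (EuclideanHalfSpace (n + 1)) X]

lemma mdifferentiable_of_mem_maximalAtlas
    (he : e ∈ IsManifold.maximalAtlas (𝓡∂ (n + 1)) ∞ X) :
    e.MDifferentiable (𝓡∂ (n + 1)) (𝓡∂ (n + 1)) :=
  ⟨(contMDiffOn_of_mem_maximalAtlas he).mdifferentiableOn (by simp),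
    (contMDiffOn_symm_of_mem_maximalAtlas he).mdifferentiableOn (by simp)⟩

/-- Interior points can be recognised in every chart of the maximal atlas. -/
lemma extend_mem_interior_target (he : e ∈ IsManifold.maximalAtlas (𝓡∂ (n + 1)) ∞ X)
    (hx : x ∈ e.source) (hxi : x ∈ (𝓡∂ (n + 1)).interior X) :
    e.extend (𝓡∂ (n + 1)) x ∈ interior (e.extend (𝓡∂ (n + 1))).target := by
  have hd := mdifferentiable_of_mem_maximalAtlas he
  have h : (𝓡∂ (n + 1)).IsInteriorPoint (e x) :=
    (hd.mdifferentiableAt hx).isInteriorPoint_of_surjective_mfderiv (hd.mfderiv_surjective hx) hxi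
  rw [ModelWithCorners.isInteriorPoint_iff] at h
  refine e.mem_interior_extend_target (e.map_source hx) ?_
  have h' := interior_mono (extChartAt_target_subset_range _) h
  rwa [extChartAt_self_eq] at h'

lemma symm_mem_interior (he : e ∈ IsManifold.maximalAtlas (𝓡∂ (n + 1)) ∞ X)
    (hy : y ∈ interior (e.extend (𝓡∂ (n + 1))).target) :
    (e.extend (𝓡∂ (n + 1))).symm y ∈ (𝓡∂ (n + 1)).interior X := by
  have hd := (mdifferentiable_of_mem_maximalAtlas he).symm
  have hyt : (𝓡∂ (n + 1)).symm y ∈ e.target := by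
    have := interior_subset hy
    rw [e.extend_target] at this
    exact this.1
  refine (hd.mdifferentiableAt hyt).isInteriorPoint_of_surjective_mfderiv
    (hd.mfderiv_surjective hyt) ?_
  rw [ModelWithCorners.IsInteriorPoint, extChartAt_self_eq,
    (𝓡∂ (n + 1)).right_inv (e.extend_target_subset_range (interior_subset hy))]
  exact interior_mono e.extend_target_subset_range hy

lemma contMDiffAt_extend_symm (he : e ∈ IsManifold.maximalAtlas (𝓡∂ (n + 1)) ∞ X)
    (hy : y ∈ interior (e.extend (𝓡∂ (n + 1))).target) :
    ContMDiffAt 𝓘(ℝ, EuclideanSpace ℝ (Fin (n + 1))) (𝓡∂ (n + 1)) ∞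
      (e.extend (𝓡∂ (n + 1))).symm y := by
  have h := contMDiffOn_extend_symm he
  rw [← e.extend_target'] at h
  exact h.contMDiffAt (mem_interior_iff_mem_nhds.mp hy)

lemma contDiffAt_inChart {f : X → ℝ} {k : WithTop ℕ∞} (hk : k ≤ ∞)
    (he : e ∈ IsManifold.maximalAtlas (𝓡∂ (n + 1)) ∞ X)
    (hy : y ∈ interior (e.extend (𝓡∂ (n + 1))).target)
    (hf : ContMDiffAt (𝓡∂ (n + 1)) 𝓘(ℝ, ℝ) k f ((e.extend (𝓡∂ (n + 1))).symm y)) :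
    ContDiffAt ℝ k (inChart e f) y :=
  contMDiffAt_iff_contDiffAt.mp (hf.comp y ((contMDiffAt_extend_symm he hy).of_le hk))

/-- The differential of the inverse chart: its value on the standard basis is the coordinate
frame. -/
noncomputable def chartFrame (e : OpenPartialHomeomorph X (EuclideanHalfSpace (n + 1)))
    (y : EuclideanSpace ℝ (Fin (n + 1))) :
    EuclideanSpace ℝ (Fin (n + 1)) →L[ℝ]
      TangentSpace (𝓡∂ (n + 1)) ((e.extend (𝓡∂ (n + 1))).symm y) :=
  mfderiv 𝓘(ℝ, EuclideanSpace ℝ (Fin (n + 1))) (𝓡∂ (n + 1)) (e.extend (𝓡∂ (n + 1))).symm y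

lemma coordField_eq_chartFrame (hy : y ∈ interior (e.extend (𝓡∂ (n + 1))).target)
    (i : Fin (n + 1)) : coordField e i y = chartFrame e y (EuclideanSpace.single i 1) := by
  have hr : Set.range (𝓡∂ (n + 1)) ∈ 𝓝 y :=
    Filter.mem_of_superset (mem_interior_iff_mem_nhds.mp hy) e.extend_target_subset_range
  rw [coordField, mfderivWithin_of_mem_nhds hr]
  rfl

lemma chartFrame_injective (he : e ∈ IsManifold.maximalAtlas (𝓡∂ (n + 1)) ∞ X)
    (hy : y ∈ interior (e.extend (𝓡∂ (n + 1))).target) :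
    Function.Injective (chartFrame e y) := by
  have h1 : MDifferentiableAt (𝓡∂ (n + 1)) 𝓘(ℝ, EuclideanSpace ℝ (Fin (n + 1)))
      (e.extend (𝓡∂ (n + 1))) ((e.extend (𝓡∂ (n + 1))).symm y) :=
    (e.contMDiffAt_extend he (symm_mem_source hy)).mdifferentiableAt (by simp)
  have h2 := (contMDiffAt_extend_symm he hy).mdifferentiableAt (by simp)
  have h3 := mfderiv_comp y h1 h2
  have h4 : e.extend (𝓡∂ (n + 1)) ∘ (e.extend (𝓡∂ (n + 1))).symm =ᶠ[𝓝 y] id :=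
    Filter.mem_of_superset (mem_interior_iff_mem_nhds.mp hy) fun z hz =>
      (e.extend (𝓡∂ (n + 1))).right_inv hz
  rw [h4.mfderiv_eq, mfderiv_id] at h3
  intro a b hab
  have ha := DFunLike.congr_fun h3 a
  have hb := DFunLike.congr_fun h3 b
  have hab' : mfderiv 𝓘(ℝ, EuclideanSpace ℝ (Fin (n + 1))) (𝓡∂ (n + 1))
      (e.extend (𝓡∂ (n + 1))).symm y a = mfderiv 𝓘(ℝ, EuclideanSpace ℝ (Fin (n + 1)))
      (𝓡∂ (n + 1)) (e.extend (𝓡∂ (n + 1))).symm y b := hab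
  exact ha.trans ((congrArg _ hab').trans hb.symm)

lemma chartFrame_surjective (he : e ∈ IsManifold.maximalAtlas (𝓡∂ (n + 1)) ∞ X)
    (hy : y ∈ interior (e.extend (𝓡∂ (n + 1))).target) :
    Function.Surjective (chartFrame e y) := by
  let L : EuclideanSpace ℝ (Fin (n + 1)) →L[ℝ] EuclideanSpace ℝ (Fin (n + 1)) := chartFrame e y
  exact (LinearMap.injective_iff_surjective (f := L.toLinearMap)).mp (chartFrame_injective he hy)

lemma sum_components_mul (g : BilinField n X)
    (hy : y ∈ interior (e.extend (𝓡∂ (n + 1))).target)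
    (w w' : EuclideanSpace ℝ (Fin (n + 1))) :
    ∑ i, ∑ j, w i * components e g y i j * w' j
      = g ((e.extend (𝓡∂ (n + 1))).symm y) (chartFrame e y w) (chartFrame e y w') := by
  conv_rhs => rw [sum_smul_single w, sum_smul_single w']
  simp only [map_sum, map_smul, components, Matrix.of_apply, coordField_eq_chartFrame hy,
    sum_apply, smul_apply, smul_eq_mul, Finset.mul_sum]
  rw [Finset.sum_comm]
  exact Finset.sum_congr rfl fun i _ => Finset.sum_congr rfl fun j _ => by ring

lemma coordPartial_inChart {f : X → ℝ} (he : e ∈ IsManifold.maximalAtlas (𝓡∂ (n + 1)) ∞ X)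
    (hy : y ∈ interior (e.extend (𝓡∂ (n + 1))).target)
    (hf : MDifferentiableAt (𝓡∂ (n + 1)) 𝓘(ℝ, ℝ) f ((e.extend (𝓡∂ (n + 1))).symm y))
    (i : Fin (n + 1)) :
    coordPartial i (inChart e f) y = mfderiv (𝓡∂ (n + 1)) 𝓘(ℝ, ℝ) f
      ((e.extend (𝓡∂ (n + 1))).symm y) (chartFrame e y (EuclideanSpace.single i 1)) := by
  have h := mfderiv_comp y hf ((contMDiffAt_extend_symm he hy).mdifferentiableAt (by simp))
  rw [mfderiv_eq_fderiv] at h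
  exact DFunLike.congr_fun h (EuclideanSpace.single i 1)

end InteriorPoints

/-! ### Poincaré–Einstein metrics in charts -/

section PoincareEinstein

variable {n : ℕ} {X : Type*} [TopologicalSpace X] [ChartedSpace (EuclideanHalfSpace (n + 1)) X]
  {e : OpenPartialHomeomorph X (EuclideanHalfSpace (n + 1))} {x : X}
  {y : EuclideanSpace ℝ (Fin (n + 1))} {g : BilinField n X} {r u : X → ℝ}

lemma IsPoincareEinstein.symm (hg : IsPoincareEinstein g)
    (hx : x ∈ (𝓡∂ (n + 1)).interior X) (v w : TangentSpace (𝓡∂ (n + 1)) x) :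
    g x v w = g x w v := by
  obtain ⟨ρ, hρ, α, -, -, h, hh, hgh⟩ := hg.conformallyCompact
  have h1 := hh.symm x v w
  rw [hgh x hx] at h1
  exact mul_left_cancel₀ (pow_ne_zero 2 (hρ.pos x hx).ne') h1

lemma IsPoincareEinstein.pos (hg : IsPoincareEinstein g)
    (hx : x ∈ (𝓡∂ (n + 1)).interior X) {v : TangentSpace (𝓡∂ (n + 1)) x} (hv : v ≠ 0) :
    0 < g x v v := by
  obtain ⟨ρ, hρ, α, -, -, h, hh, hgh⟩ := hg.conformallyCompact
  have h1 := hh.pos x v hv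
  rw [hgh x hx] at h1
  exact pos_of_mul_pos_right h1 (sq_nonneg (ρ x))

/-- Inside a chart, the metric `g = ρ⁻² (ρ² g)` is as regular as its conformal
compactification. -/
lemma IsPoincareEinstein.contDiffAt_components (hg : IsPoincareEinstein g)
    (he : e ∈ IsManifold.maximalAtlas (𝓡∂ (n + 1)) ∞ X)
    (hy : y ∈ interior (e.extend (𝓡∂ (n + 1))).target) (i j : Fin (n + 1)) :
    ContDiffAt ℝ 3 (fun z => components e g z i j) y := by
  obtain ⟨ρ, hρ, α, -, -, h, hh, hgh⟩ := hg.conformallyCompact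
  have h1 : ContDiffAt ℝ 3 (fun z => components e h z i j) y :=
    (hh.regular e he i j).1.contDiffAt (mem_interior_iff_mem_nhds.mp hy)
  have hle : (3 : WithTop ℕ∞) ≤ ∞ := WithTop.coe_le_coe.mpr le_top
  have h2 : ContDiffAt ℝ 3 (inChart e ρ) y :=
    contDiffAt_inChart hle he hy ((hρ.smooth _).of_le hle)
  have h0 : ∀ z ∈ interior (e.extend (𝓡∂ (n + 1))).target, inChart e ρ z ^ 2 ≠ 0 := fun z hz =>
    pow_ne_zero 2 (hρ.pos _ (symm_mem_interior he hz)).ne'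
  refine (((h2.pow 2).inv (h0 y hy)).mul h1).congr_of_eventuallyEq ?_
  filter_upwards [isOpen_interior.mem_nhds hy] with z hz
  have h3 : components e h z i j = inChart e ρ z ^ 2 * components e g z i j := by
    rw [components, Matrix.of_apply, hgh _ (symm_mem_interior he hz)]
    rfl
  change components e g z i j = (inChart e ρ z ^ 2)⁻¹ * components e h z i j
  rw [h3, inv_mul_cancel_left₀ (h0 z hz)]

lemma IsPoincareEinstein.posDef_components (hg : IsPoincareEinstein g)
    (he : e ∈ IsManifold.maximalAtlas (𝓡∂ (n + 1)) ∞ X)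
    (hy : y ∈ interior (e.extend (𝓡∂ (n + 1))).target) : (components e g y).PosDef := by
  have hx := symm_mem_interior he hy
  refine Matrix.PosDef.of_dotProduct_mulVec_pos ?_ fun a ha => ?_
  · ext i j
    simp only [Matrix.conjTranspose_apply, star_trivial, components, Matrix.of_apply]
    exact hg.symm hx _ _
  · have h := sum_components_mul g hy (WithLp.toLp 2 a) (WithLp.toLp 2 a)
    have hne : chartFrame e y (WithLp.toLp 2 a) ≠ 0 := fun h0 => ha <| by
      have := chartFrame_injective he hy (h0.trans (map_zero (chartFrame e y)).symm)
      simpa using this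
    have hp := hg.pos hx hne
    rw [← h] at hp
    simpa [dotProduct, Matrix.mulVec, Finset.mul_sum, mul_assoc] using hp

lemma IsNormalizedEigenfunction.contMDiffAt [IsManifold (𝓡∂ (n + 1)) ∞ X]
    (hu : IsNormalizedEigenfunction g r u) (hx : x ∈ (𝓡∂ (n + 1)).interior X) :
    ContMDiffAt (𝓡∂ (n + 1)) 𝓘(ℝ, ℝ) 3 u x :=
  hu.regular.contMDiffAt
    (((𝓡∂ (n + 1)).isOpen_interior (M := X) (n := ∞) (by simp)).mem_nhds hx)

/-- In every chart, a Poincaré–Einstein metric with its eigenfunction is an Einstein eigenpair. -/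
lemma isEinsteinEigenpairOn_components [IsManifold (𝓡∂ (n + 1)) ∞ X] (hg : IsPoincareEinstein g)
    (hu : IsNormalizedEigenfunction g r u)
    (he : e ∈ IsManifold.maximalAtlas (𝓡∂ (n + 1)) ∞ X) :
    IsEinsteinEigenpairOn (components e g) (inChart e u)
      (interior (e.extend (𝓡∂ (n + 1))).target) where
  metric :=
    { isOpen := isOpen_interior
      posDef := fun y hy => hg.posDef_components he hy
      contDiffAt := fun y hy i j => (hg.contDiffAt_components he hy i j).of_le (by norm_num) }
  einstein := fun y hy i j => by
    have h := congrFun (congrFun (hg.einstein e he _ (symm_mem_source hy)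
      (symm_mem_interior he hy)) i) j
    rw [extend_symm_eq hy, ricci, Matrix.of_apply, extend_symm_eq hy] at h
    rw [h]
    simp
  contDiffAt := fun y hy => contDiffAt_inChart (WithTop.coe_le_coe.mpr le_top) he hy
    (hu.contMDiffAt (symm_mem_interior he hy))
  pos := fun y hy => hu.pos _ (symm_mem_interior he hy)
  eigen := fun y hy => by
    have h := hu.eigen e he _ (symm_mem_source hy) (symm_mem_interior he hy)
    dsimp only at h
    rw [laplacian, extend_symm_eq hy] at h
    rw [h]
    simp [inChart]

/-- The metric dual of `du` computes `|du|²`. -/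
lemma exists_metric_dual_mfderiv [IsManifold (𝓡∂ (n + 1)) ∞ X] (hg : IsPoincareEinstein g)
    (hu : IsNormalizedEigenfunction g r u)
    (he : e ∈ IsManifold.maximalAtlas (𝓡∂ (n + 1)) ∞ X)
    (hx : x ∈ e.source) (hxi : x ∈ (𝓡∂ (n + 1)).interior X) :
    ∃ w : TangentSpace (𝓡∂ (n + 1)) x,
      (∀ a, g x w a = mfderiv (𝓡∂ (n + 1)) 𝓘(ℝ, ℝ) u x a) ∧
      mfderiv (𝓡∂ (n + 1)) 𝓘(ℝ, ℝ) u x w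
        = coordNormSqDiff (components e g) (inChart e u) (e.extend (𝓡∂ (n + 1)) x) := by
  have key : ∀ y ∈ interior (e.extend (𝓡∂ (n + 1))).target,
      ∃ w : TangentSpace (𝓡∂ (n + 1)) ((e.extend (𝓡∂ (n + 1))).symm y),
        (∀ a, g ((e.extend (𝓡∂ (n + 1))).symm y) w a
          = mfderiv (𝓡∂ (n + 1)) 𝓘(ℝ, ℝ) u ((e.extend (𝓡∂ (n + 1))).symm y) a) ∧
        mfderiv (𝓡∂ (n + 1)) 𝓘(ℝ, ℝ) u ((e.extend (𝓡∂ (n + 1))).symm y) w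
          = coordNormSqDiff (components e g) (inChart e u) y := by
    intro y hy
    have hE := isEinsteinEigenpairOn_components hg hu he
    have hd : ∀ a : EuclideanSpace ℝ (Fin (n + 1)),
        mfderiv (𝓡∂ (n + 1)) 𝓘(ℝ, ℝ) u ((e.extend (𝓡∂ (n + 1))).symm y) (chartFrame e y a)
          = ∑ i, a i * coordPartial i (inChart e u) y := fun a => by
      conv_lhs => rw [sum_smul_single a]
      simp only [map_sum, map_smul, coordPartial_inChart he hy
        ((hu.contMDiffAt (symm_mem_interior he hy)).mdifferentiableAt (by norm_num))]
      rfl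
    refine ⟨chartFrame e y (WithLp.toLp 2 fun k =>
      coordGradient (components e g) (inChart e u) k y), fun a => ?_, ?_⟩
    · obtain ⟨a, rfl⟩ := chartFrame_surjective he hy a
      rw [← sum_components_mul g hy, hd, Finset.sum_comm]
      refine Finset.sum_congr rfl fun j _ => ?_
      rw [← hE.metric.sum_metric_mul_coordGradient hy, Finset.mul_sum]
      exact Finset.sum_congr rfl fun i _ => by rw [hE.metric.apply_comm hy j i]; ring
    · rw [hd]
      rfl
  have h := key _ (extend_mem_interior_target he hx hxi)
  rwa [e.extend_left_inv hx] at h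

/-- `|du|²` does not depend on the chart. -/
lemma coordNormSqDiff_eq_of_charts [IsManifold (𝓡∂ (n + 1)) ∞ X] (hg : IsPoincareEinstein g)
    (hu : IsNormalizedEigenfunction g r u)
    {e' : OpenPartialHomeomorph X (EuclideanHalfSpace (n + 1))}
    (he : e ∈ IsManifold.maximalAtlas (𝓡∂ (n + 1)) ∞ X)
    (he' : e' ∈ IsManifold.maximalAtlas (𝓡∂ (n + 1)) ∞ X)
    (hx : x ∈ e.source) (hx' : x ∈ e'.source) (hxi : x ∈ (𝓡∂ (n + 1)).interior X) :
    coordNormSqDiff (components e g) (inChart e u) (e.extend (𝓡∂ (n + 1)) x)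
      = coordNormSqDiff (components e' g) (inChart e' u) (e'.extend (𝓡∂ (n + 1)) x) := by
  obtain ⟨w, hw, hw2⟩ := exists_metric_dual_mfderiv hg hu he hx hxi
  obtain ⟨w', hw', hw2'⟩ := exists_metric_dual_mfderiv hg hu he' hx' hxi
  rw [← hw2, ← hw2', ← hw', ← hw, hg.symm hxi]

lemma components_conformalMetric :
    components e (conformalMetric g u) = fun z => (inChart e u z ^ 2)⁻¹ • components e g z := rfl

/-- If `∇²u = u g` in all charts, then `u² - |du|²` is constant on the connected interior. -/
lemma exists_sq_sub_coordNormSqDiff_eq [IsManifold (𝓡∂ (n + 1)) ∞ X]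
    (hX : IsConnected ((𝓡∂ (n + 1)).interior X)) (hg : IsPoincareEinstein g)
    (hu : IsNormalizedEigenfunction g r u)
    (hb : InteriorCharts (n := n) fun e x => hessianDefect g u e x = 0) :
    ∃ c : ℝ, InteriorCharts (n := n) fun e x => u x ^ 2
      - coordNormSqDiff (components e g) (inChart e u) (e.extend (𝓡∂ (n + 1)) x) = c := by
  -- `u² - |du|²` as a function on `X`, computed at each point in the preferred chart there
  let φ : X → ℝ := fun x => u x ^ 2 - coordNormSqDiff (components (chartAt _ x) g)
    (inChart (chartAt _ x) u) ((chartAt (EuclideanHalfSpace (n + 1)) x).extend (𝓡∂ (n + 1)) x)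
  have hφ : InteriorCharts (n := n) fun e x => u x ^ 2
      - coordNormSqDiff (components e g) (inChart e u) (e.extend (𝓡∂ (n + 1)) x) = φ x :=
    fun e he x hx hxi => by
      dsimp only
      rw [coordNormSqDiff_eq_of_charts hg hu he (IsManifold.chart_mem_maximalAtlas x) hx
        (mem_chart_source _ x) hxi]
  have hloc : ∀ x ∈ (𝓡∂ (n + 1)).interior X, ∀ᶠ z in 𝓝 x,
      z ∈ (𝓡∂ (n + 1)).interior X → φ z = φ x := by
    intro x hxi
    set e := chartAt (EuclideanHalfSpace (n + 1)) x with he_def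
    have he : e ∈ IsManifold.maximalAtlas (𝓡∂ (n + 1)) ∞ X := IsManifold.chart_mem_maximalAtlas x
    have hx : x ∈ e.source := mem_chart_source _ x
    have hE := isEinsteinEigenpairOn_components hg hu he
    have hy := extend_mem_interior_target he hx hxi
    obtain ⟨ε, hε, hball⟩ := Metric.isOpen_iff.mp isOpen_interior _ hy
    have hd : ∀ z ∈ Metric.ball (e.extend (𝓡∂ (n + 1)) x) ε,
        DifferentiableAt ℝ (fun z => inChart e u z ^ 2
          - coordNormSqDiff (components e g) (inChart e u) z) z := fun z hz =>
      hE.differentiableAt_sq_sub_coordNormSqDiff (hball hz)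
    have hd0 : ∀ z ∈ Metric.ball (e.extend (𝓡∂ (n + 1)) x) ε,
        fderiv ℝ (fun z => inChart e u z ^ 2
          - coordNormSqDiff (components e g) (inChart e u) z) z = 0 := fun z hz => by
      refine hE.fderiv_sq_sub_coordNormSqDiff (hball hz) fun i j => ?_
      have h := congrFun (congrFun (hb e he _ (symm_mem_source (hball hz))
        (symm_mem_interior he (hball hz))) i) j
      rw [hessianDefect, hessian, extend_symm_eq (hball hz)] at h
      exact sub_eq_zero.mp h
    have hcont := e.continuousAt_extend (I := 𝓡∂ (n + 1)) hx
    filter_upwards [hcont.preimage_mem_nhds (Metric.ball_mem_nhds _ hε),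
      e.open_source.mem_nhds hx] with z hz hzs hzi
    rw [← hφ e he z hzs hzi, ← hφ e he x hx hxi, ← inChart_extend (u := u) hzs,
      ← inChart_extend (u := u) hx]
    exact Metric.isOpen_ball.is_const_of_fderiv_eq_zero (convex_ball _ _).isPreconnected
      (fun z hz => (hd z hz).differentiableWithinAt) (fun z hz => hd0 z hz) hz
      (Metric.mem_ball_self hε)
  obtain ⟨x₀, hx₀⟩ := hX.nonempty
  refine ⟨φ x₀, fun e he x hx hxi => (hφ e he x hx hxi).trans ?_⟩
  have := isPreconnected_iff_preconnectedSpace.mp hX.isPreconnected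
  have hlc : IsLocallyConstant fun z : (𝓡∂ (n + 1)).interior X => φ z := by
    refine (IsLocallyConstant.iff_eventually_eq _).mpr fun z => ?_
    exact (continuous_subtype_val.continuousAt.eventually (hloc z z.2)).mono fun w hw => hw w.2
  exact hlc.apply_eq_of_preconnectedSpace ⟨x, hxi⟩ ⟨x₀, hx₀⟩

end PoincareEinstein

/-! ### The trace-free Ricci tensor of `u⁻² g` -/

theorem mainTheorem8 (n : ℕ) {X : Type*} [TopologicalSpace X] [T2Space X] [CompactSpace X]
    [ChartedSpace (EuclideanHalfSpace (n + 1)) X] [IsManifold (𝓡∂ (n + 1)) ∞ X]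
    (hX : IsConnected ((𝓡∂ (n + 1)).interior X))
    (g : BilinField n X) (hg : IsPoincareEinstein g)
    (r : X → ℝ) (hr : IsDefiningFunction (n := n) r)
    (u : X → ℝ) (hu : IsNormalizedEigenfunction g r u) :
    InteriorCharts (n := n) (fun e x =>
      traceFreeRicci (conformalMetric g u) e x
        = (((n : ℝ) - 1) / u x) • hessianDefect g u e x) ∧
    (InteriorCharts (n := n) (fun e x => hessianDefect g u e x = 0) ↔
      ∃ c : ℝ, InteriorCharts (n := n) fun e x =>
        scalarCurvature (conformalMetric g u) e x = c) := by
  have hR : InteriorCharts (n := n) fun e x => scalarCurvature (conformalMetric g u) e x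
      = (n + 1) * n * (u x ^ 2
        - coordNormSqDiff (components e g) (inChart e u) (e.extend (𝓡∂ (n + 1)) x)) := by
    intro e he x hx hxi
    rw [scalarCurvature, components_conformalMetric,
      (isEinsteinEigenpairOn_components hg hu he).coordScalar_conformal
        (extend_mem_interior_target he hx hxi), inChart_extend hx]
    push_cast
    ring
  refine ⟨fun e he x hx hxi => ?_, fun hb => ?_, fun ⟨c, hc⟩ e he x hx hxi => ?_⟩
  · ext i j
    rw [traceFreeRicci, Matrix.of_apply, components_conformalMetric,
      (isEinsteinEigenpairOn_components hg hu he).coordTraceFreeRicci_conformal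
        (extend_mem_interior_target he hx hxi), inChart_extend hx]
    simp only [hessianDefect, hessian, Matrix.smul_apply, Matrix.sub_apply, Matrix.of_apply,
      smul_eq_mul]
    push_cast
    ring
  · obtain ⟨c, hc⟩ := exists_sq_sub_coordNormSqDiff_eq hX hg hu hb
    exact ⟨(n + 1) * n * c, fun e he x hx hxi =>
      (hR e he x hx hxi).trans (congrArg _ (hc e he x hx hxi))⟩
  · have hE := isEinsteinEigenpairOn_components hg hu he
    have hy := extend_mem_interior_target he hx hxi
    suffices h : ∀ i j, coordHessian (components e g) (inChart e u) i j
        (e.extend (𝓡∂ (n + 1)) x) = inChart e u (e.extend (𝓡∂ (n + 1)) x)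
          * components e g (e.extend (𝓡∂ (n + 1)) x) i j by
      ext i j
      rw [hessianDefect, hessian, Matrix.sub_apply, Matrix.of_apply, h, inChart_extend hx,
        Matrix.smul_apply, smul_eq_mul, sub_self, Matrix.zero_apply]
    rcases Nat.eq_zero_or_pos n with rfl | hn
    · exact hE.coordHessian_eq_of_dim_eq_one hy rfl
    · refine hE.coordHessian_eq_of_eventually_const hy (c := c / ((n + 1) * n)) ?_
      filter_upwards [isOpen_interior.mem_nhds hy] with z hz
      have h1 := (hc e he _ (symm_mem_source hz) (symm_mem_interior he hz)).symm.trans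
        (hR e he _ (symm_mem_source hz) (symm_mem_interior he hz))
      rw [extend_symm_eq hz] at h1
      rw [h1, mul_div_cancel_left₀ _ (by positivity)]
      rfl
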